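/- Let $G=(V,E,w)$ be a finite undirected graph with nonnegative symmetric edge weights ($w_{xy}=0$ when $(x,y)\notin E$), degrees $d_x=\sum_y w_{xy}$, and a non-empty sink $M\subseteq V$; put $n=|V|$, $m=|M|$. For $x\in V\setminus M$: - the electric flow $f_x$ is the unit flow from $x$ to $M$ that minimizes the energy $\mathcal E(f)=\frac12\sum_{(y,z)\in E} f_{yz}^2/w_{yz}$, and $R_x=\mathcal E(f_x)$ is the effective resistance; - for the random walk $(X_t)$ with $X_0=x$ and transition probabilities $w_{yz}/d_y$, let $\tau=\min\{t: X_t\in M\}$; the hitting time is $\mathrm{HT}_x=\mathbb E[\tau]$ and the escape time is $\mathrm{ET}_x=\mathbb E[1+\max\{t<\tau: X_t=x\}]$; - the elfs process is the Markov chain $(Y_t)$ with $Y_0=x$ that moves from $y\notin M$ to $y'$ with probability $\frac{1}{2R_y}\sum_{z:(y',z)\in E}(f_y)_{y'z}^2/w_{y'z}$ and stops in $M$; the electric hitting time is $\mathrm{EHT}_x=\mathbb E[\min\{t: Y_t\in M\}]$. For $x\in M$ all four quantities are $0$. Theorem. For all $\delta>0$ and $0<d_0\le D$ there are constants $c,C>0$,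 depending only on $\delta,d_0,D$, such that the following holds. Let $G$ be regular of degree $d\in[d_0,D]$, that is, $d_x=d$ for all $x$ (for unweighted graphs with at least one edge, $w\in\{0,1\}$, one can take $d_0=1$), and let $G$ be an expander with spectral gap at least $\delta$: every eigenvalue of the transition matrix $(w_{xy}/d)_{x,y}$ that has an eigenvector orthogonal to the constant vectors is at most $1-\delta$. Then for every non-empty $M\subseteq V$ and every $x\in V$, \[ R_x\le C,\qquad R_x\ge c \ \text{ if } x\notin M,\qquad \mathrm{ET}_x\le C\Big(1+\frac{n}{m^2}\Big), \] \[ \mathrm{EHT}_x\le C\min\Big\{m,\ \frac nm+\log n\Big\},\qquad \mathrm{HT}_x\le C\Big(\frac nm+\log n\Big). \] -/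

import Mathlib

open MeasureTheory ProbabilityTheory
open scoped ENNReal

noncomputable section

/-- An undirected graph on `V` with symmetric nonnegative edge weights; `(x, y)` is an edge iff
`w x y > 0`. Unweighted graphs are those with weights in `{0, 1}`. -/
structure WeightedGraph (V : Type*) where
  w : V → V → ℝ
  symm : ∀ x y, w x y = w y x
  nonneg : ∀ x y, 0 ≤ w x y

/-! ### Homogeneous Markov chains on a finite state space -/

section Chain

variable {V : Type*} [Fintype V]

open Classical in
/-- One step from `x` of the chain with transition probabilities `p`. A row of `p` that is not a
probability vector (there is no step to make) makes `x` absorbing. -/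
def stepLaw (p : V → V → ℝ) (x : V) : PMF V :=
  if h : (∀ y, 0 ≤ p x y) ∧ ∑ y, p x y = 1 then
    PMF.ofFintype (fun y => ENNReal.ofReal (p x y)) (by
      rw [← ENNReal.ofReal_sum_of_nonneg (fun y _ => h.1 y), h.2, ENNReal.ofReal_one])
  else PMF.pure x

variable [MeasurableSpace V] [DiscreteMeasurableSpace V]

/-- The transition probabilities as a Markov kernel. -/
def stepKernel (p : V → V → ℝ) : Kernel V V where
  toFun x := (stepLaw p x).toMeasure
  measurable' := Measurable.of_discrete

instance (p : V → V → ℝ) : IsMarkovKernel (stepKernel p) where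
  isProbabilityMeasure x := by
    change IsProbabilityMeasure (stepLaw p x).toMeasure
    infer_instance

/-- The kernel that gives the law of the `(t+1)`-st state from the history up to time `t`: it only
looks at the last state. -/
def historyKernel (p : V → V → ℝ) (t : ℕ) : Kernel (Finset.Iic t → V) V :=
  (stepKernel p).comap (fun h => h ⟨t, Finset.mem_Iic.2 le_rfl⟩) (measurable_pi_apply _)

instance (p : V → V → ℝ) (t : ℕ) : IsMarkovKernel (historyKernel p t) := by
  unfold historyKernel
  infer_instance

/-- The law, on the space of trajectories, of the Markov chain with transition probabilities `p`
started from `s`. -/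
def chainLaw (p : V → V → ℝ) (s : V) : Measure (ℕ → V) :=
  Kernel.traj (X := fun _ => V) (historyKernel p) 0 (fun _ => s)

end Chain

/-- The first time at which a trajectory is in `M` (`∞` if there is none). -/
def firstHit {V : Type*} (M : Finset V) (ω : ℕ → V) : ℝ≥0∞ :=
  ⨅ (t : ℕ) (_ : ω t ∈ M), (t : ℝ≥0∞)

/-- `1 + max {t < τ_M : ω t = s}`: the time at which a trajectory leaves `s` for the last time
before it hits `M` (`0` if there is no visit to `s` before hitting `M`). -/
def lastExit {V : Type*} (M : Finset V) (s : V) (ω : ℕ → V) : ℝ≥0∞ :=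
  ⨆ (t : ℕ) (_ : (t : ℝ≥0∞) < firstHit M ω ∧ ω t = s), ((t : ℝ≥0∞) + 1)

namespace WeightedGraph

variable {V : Type*} [Fintype V] (G : WeightedGraph V)

/-- The (weighted) degree. -/
def degree (x : V) : ℝ := ∑ y, G.w x y

/-- All vertices have degree `d`. -/
def IsRegular (d : ℝ) : Prop := ∀ x, G.degree x = d

/-! ### Electric flows -/

/-- `g` is a unit flow from `s` to the sink `M`, carried by the edges of `G`. -/
structure IsUnitFlow (s : V) (M : Finset V) (g : V → V → ℝ) : Prop where
  supported : ∀ x y, G.w x y = 0 → g x y = 0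
  antisymm : ∀ x y, g x y = -g y x
  source : ∑ y, g s y = 1
  sink : ∑ a ∈ M, ∑ y, g y a = 1
  conserved : ∀ x, x ≠ s → x ∉ M → ∑ z, g x z = 0

/-- The dissipated energy; `g x y ^ 2 / G.w x y = 0` off the edges of `G`. -/
def energy (g : V → V → ℝ) : ℝ := 1 / 2 * ∑ x, ∑ y, g x y ^ 2 / G.w x y

/-- `f` is a unit flow of least energy. -/
def IsElectricFlow (s : V) (M : Finset V) (f : V → V → ℝ) : Prop :=
  G.IsUnitFlow s M f ∧ ∀ g, G.IsUnitFlow s M g → G.energy f ≤ G.energy g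

open Classical in
/-- The unit electric flow from `s` to `M`, and zero if there is no such flow
(as for `s ∈ M`). -/
def electricFlow (s : V) (M : Finset V) : V → V → ℝ :=
  if h : ∃ f, G.IsElectricFlow s M f then h.choose else 0

/-- The effective resistance `R_s`. -/
def effectiveResistance (M : Finset V) (s : V) : ℝ := G.energy (G.electricFlow s M)

/-! ### The random walk and the elfs process -/

/-- Transition probabilities of the random walk. -/
def walkProb (x y : V) : ℝ := G.w x y / G.degree x

/-- Transition probabilities of the elfs process with sink `M`: from `x`, sample an edge with
probability proportional to the energy on it of the electric flow from `x` to `M`, and move to one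
of its two endpoints with probability `1 / 2` each. -/
def elfsProb (M : Finset V) (x y : V) : ℝ :=
  1 / (2 * G.effectiveResistance M x) * ∑ z, G.electricFlow x M y z ^ 2 / G.w y z

/-- The random walk has spectral gap `1 - λ₂` at least `δ`: an eigenvalue of the transition matrix
with an eigenvector orthogonal to the constants is at most `1 - δ`. (To be used for regular
graphs, whose transition matrix is symmetric.) -/
def HasSpectralGap (δ : ℝ) : Prop :=
  ∀ (μ : ℝ) (u : V → ℝ), u ≠ 0 → ∑ x, u x = 0 →
    Matrix.mulVec (Matrix.of G.walkProb) u = μ • u → μ ≤ 1 - δ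

variable [MeasurableSpace V] [DiscreteMeasurableSpace V]

/-- `HT_s`: the expected time at which the random walk from `s` hits `M`. -/
def hittingTime (M : Finset V) (s : V) : ℝ≥0∞ :=
  ∫⁻ ω, firstHit M ω ∂chainLaw G.walkProb s

/-- `ET_s`: the expected time at which the random walk from `s` leaves `s` for the last time
before hitting `M`. -/
def escapeTime (M : Finset V) (s : V) : ℝ≥0∞ :=
  ∫⁻ ω, lastExit M s ω ∂chainLaw G.walkProb s

/-- `EHT_s`: the expected number of steps after which the elfs process from `s` hits `M`. -/
def electricHittingTime (M : Finset V) (s : V) : ℝ≥0∞ :=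
  ∫⁻ ω, firstHit M ω ∂chainLaw (G.elfsProb M) s

end WeightedGraph

end

/-!
The potential `v` of the electric flow from `x` to `M` is the Green function: `L v = δ_x` off `M`
and `v = 0` on `M`, where `L` is the graph Laplacian; thus `R_x = v x`. First-step analysis bounds
the mean stopping time of a Markov chain by any supersolution of its Poisson equation.

* Hitting time: `h` with `L h = deg` off `M` is a supersolution. The spectral gap is a Poincaré
  inequality with constant `κ = δ d`. It bounds the mean of `h` by a multiple of `n / m`; applied
  to truncations of `h`, it shows that the upper level sets of `h` shrink geometrically, so that
  `h` exceeds twice its mean by at most a multiple of `log n`.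
* Elfs process: a step from `x` changes a function `φ` on average by `-(v² ⬝ L φ) / (2 v x)`, so
  `2 h` is a supersolution. By Cauchy–Schwarz, each step enters `M` with probability at least
  `1 / (2 R ∑ a ∈ M, deg a)` when all resistances are at most `R`; this gives the bound by `m`.
* Escape time: `v / v x` is the probability of still visiting `x` before `M`, and its sum along
  the walk is the escape time, which comes out as `(deg ⬝ v²) / v x`. Split `v` into its mean, which
  is `h x / (d n)` by reciprocity, and its fluctuation, which the Poincaré inequality controls.
-/

noncomputable section

open scoped BigOperators

/-! ### First-step analysis of Markov chains -/

section Chain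

/-- The trajectory that starts at `x` and then follows `ω`. -/
def consPath {V : Type*} (x : V) (ω : ℕ → V) : ℕ → V
  | 0 => x
  | t + 1 => ω t

@[simp]
theorem consPath_zero {V : Type*} (x : V) (ω : ℕ → V) : consPath x ω 0 = x := rfl

@[simp]
theorem consPath_succ {V : Type*} (x : V) (ω : ℕ → V) (t : ℕ) : consPath x ω (t + 1) = ω t := rfl

theorem dependsOn_comp_consPath {V β : Type*} {k : ℕ} {F : (ℕ → V) → β}
    (hF : DependsOn F (Set.Iic (k + 1))) (x : V) :
    DependsOn (fun ω => F (consPath x ω)) (Set.Iic k) := fun _ _ h => hF fun t ht => by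
  cases t with
  | zero => rfl
  | succ t => exact h t (Nat.succ_le_succ_iff.1 ht)

theorem measurable_of_dependsOn_Iic {V β : Type*} [Finite V] [MeasurableSpace V]
    [DiscreteMeasurableSpace V] [MeasurableSpace β] {k : ℕ} {F : (ℕ → V) → β}
    (hF : DependsOn F (Set.Iic k)) : Measurable F := by
  obtain hV | ⟨⟨x⟩⟩ := isEmpty_or_nonempty V
  · exact measurable_of_empty F
  have hfactor : F = (fun h : Finset.Iic k → V =>
      F (Function.updateFinset (fun _ => x) (Finset.Iic k) h)) ∘ Preorder.frestrictLe k := by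
    funext ω
    refine hF fun t ht => ?_
    have ht : t ≤ k := ht
    simp [Function.updateFinset, ht]
  rw [hfactor]
  exact Measurable.of_discrete.comp (Preorder.measurable_frestrictLe k)

variable {V : Type*} [Fintype V] [MeasurableSpace V] [DiscreteMeasurableSpace V]

instance (p : V → V → ℝ) (s : V) : IsProbabilityMeasure (chainLaw p s) := by
  unfold chainLaw
  infer_instance

theorem lintegral_chainLaw_of_dependsOn_zero (p : V → V → ℝ) (s : V) {F : (ℕ → V) → ℝ≥0∞}
    (hF : DependsOn F (Set.Iic 0)) : ∫⁻ ω, F ω ∂chainLaw p s = F fun _ => s := by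
  have hstart : ∀ ω : ℕ → V, F (Function.updateFinset ω (Finset.Iic 0) fun _ => s) = F fun _ => s :=
    fun ω => hF fun t ht => by simp_all [Function.updateFinset]
  rw [chainLaw, Kernel.lintegral_traj _ (measurable_of_dependsOn_Iic hF), ← chainLaw]
  simp only [hstart, lintegral_const, measure_univ, mul_one]

theorem lintegral_chainLaw_last_step (p : V → V → ℝ) (s : V) {k : ℕ} {F : (ℕ → V) → ℝ≥0∞}
    (hF : DependsOn F (Set.Iic (k + 1))) :
    ∫⁻ ω, F ω ∂chainLaw p s =
      ∫⁻ ω, ∫⁻ y, F (Function.update ω (k + 1) y) ∂stepKernel p (ω k) ∂chainLaw p s := by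
  let extend (h : Finset.Iic k → V) (y : V) : ℕ → V :=
    Function.updateFinset (fun _ => y) (Finset.Iic k) h
  have hextend (ω : ℕ → V) (y : V) :
      F (Function.update ω (k + 1) y) = F (extend (Preorder.frestrictLe k ω) y) :=
    hF fun t ht => by
      obtain rfl | ht : t = k + 1 ∨ t ≤ k := by have := Set.mem_Iic.1 ht; omega
      · simp [extend, Function.updateFinset]
      · simp [extend, Function.updateFinset, ht, (Nat.lt_succ_of_le ht).ne]
  have hself (ω : ℕ → V) : F ω = F (extend (Preorder.frestrictLe k ω) (ω (k + 1))) := by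
    rw [← hextend, Function.update_eq_self]
  have hjoint := Kernel.partialTraj_compProd_eq_map_traj (X := fun _ => V) (κ := historyKernel p)
    (Nat.zero_le k) (x₀ := fun _ => s)
  have hpast := Kernel.traj_map_frestrictLe_apply (X := fun _ => V) (κ := historyKernel p) 0 k
    (fun _ => s)
  have hmeas : Measurable fun q : (Finset.Iic k → V) × V => F (extend q.1 q.2) :=
    Measurable.of_discrete
  calc ∫⁻ ω, F ω ∂chainLaw p s
      = ∫⁻ q, F (extend q.1 q.2) ∂(chainLaw p s).map
          fun ω => (Preorder.frestrictLe (π := fun _ => V) k ω, ω (k + 1)) := by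
        rw [lintegral_map hmeas
          ((Preorder.measurable_frestrictLe k).prodMk (measurable_pi_apply (k + 1)))]
        exact lintegral_congr hself
    _ = ∫⁻ h, ∫⁻ y, F (extend h y) ∂historyKernel p k h
          ∂Kernel.partialTraj (X := fun _ => V) (historyKernel p) 0 k (fun _ => s) := by
        rw [chainLaw, ← hjoint, Measure.lintegral_compProd hmeas]
    _ = ∫⁻ ω, ∫⁻ y, F (Function.update ω (k + 1) y) ∂stepKernel p (ω k) ∂chainLaw p s := by
        rw [← hpast, lintegral_map Measurable.of_discrete (Preorder.measurable_frestrictLe k)]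
        simp only [hextend]
        rfl

theorem dependsOn_lintegral_update (p : V → V → ℝ) {k : ℕ} {F : (ℕ → V) → ℝ≥0∞}
    (hF : DependsOn F (Set.Iic (k + 1))) :
    DependsOn (fun ω => ∫⁻ y, F (Function.update ω (k + 1) y) ∂stepKernel p (ω k))
      (Set.Iic k) := fun ω ω' h => by
  simp only [h k (Set.mem_Iic.2 le_rfl)]
  refine lintegral_congr fun y => hF fun t ht => ?_
  obtain rfl | ht : t = k + 1 ∨ t ≤ k := by have := Set.mem_Iic.1 ht; omega
  · simp
  · simp only [Function.update_of_ne (Nat.lt_succ_of_le ht).ne, h t ht]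

theorem lintegral_chainLaw_first_step (p : V → V → ℝ) (s : V) {k : ℕ} {F : (ℕ → V) → ℝ≥0∞}
    (hF : DependsOn F (Set.Iic (k + 1))) :
    ∫⁻ ω, F ω ∂chainLaw p s =
      ∫⁻ y, ∫⁻ ω, F (consPath s ω) ∂chainLaw p y ∂stepKernel p s := by
  have hcons := dependsOn_comp_consPath hF s
  have hlast := dependsOn_lintegral_update p hF
  induction k generalizing F with
  | zero =>
    rw [lintegral_chainLaw_last_step p s hF, lintegral_chainLaw_of_dependsOn_zero p s hlast]
    refine lintegral_congr fun y => ?_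
    rw [lintegral_chainLaw_of_dependsOn_zero p y hcons]
    refine hF fun t ht => ?_
    obtain rfl | rfl : t = 0 ∨ t = 1 := by have := Set.mem_Iic.1 ht; omega
    · rfl
    · simp
  | succ k ih =>
    have hcomm (ω : ℕ → V) (y : V) :
        Function.update (consPath s ω) (k + 2) y = consPath s (Function.update ω (k + 1) y) := by
      funext t
      cases t <;> simp [Function.update_apply]
    rw [lintegral_chainLaw_last_step p s hF, ih hlast (dependsOn_comp_consPath hlast s)
      (dependsOn_lintegral_update p hlast)]
    refine lintegral_congr fun y => ?_
    rw [lintegral_chainLaw_last_step p y hcons]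
    simp only [hcomm, consPath_succ]

theorem lintegral_stepKernel_ofReal {p : V → V → ℝ} {x : V} (hp : p x ∈ stdSimplex ℝ V)
    {g : V → ℝ} (hg : ∀ y, 0 ≤ g y) :
    ∫⁻ y, ENNReal.ofReal (g y) ∂stepKernel p x = ENNReal.ofReal (p x ⬝ᵥ g) := by
  change ∫⁻ y, ENNReal.ofReal (g y) ∂(stepLaw p x).toMeasure = _
  rw [stepLaw, dif_pos (by exact hp), lintegral_fintype, dotProduct,
    ENNReal.ofReal_sum_of_nonneg fun y _ => mul_nonneg (hp.1 y) (hg y)]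
  refine Finset.sum_congr rfl fun y _ => ?_
  rw [PMF.toMeasure_apply_singleton _ _ (MeasurableSet.singleton y), PMF.ofFintype_apply,
    ENNReal.ofReal_mul (hp.1 y), mul_comm]

end Chain

/-! ### Hitting and last-exit times -/

section Times

section Paths

variable {V : Type*} {M : Finset V}

theorem firstHit_le {ω : ℕ → V} {t : ℕ} (ht : ω t ∈ M) : firstHit M ω ≤ t :=
  iInf₂_le (f := fun (t : ℕ) (_ : ω t ∈ M) => (t : ℝ≥0∞)) t ht

theorem natCast_lt_firstHit_iff {ω : ℕ → V} {t : ℕ} :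
    (t : ℝ≥0∞) < firstHit M ω ↔ ∀ j ≤ t, ω j ∉ M := by
  refine ⟨fun h j hj hjM => h.not_ge <| (firstHit_le hjM).trans (by exact_mod_cast hj), fun h => ?_⟩
  have hle : (t : ℝ≥0∞) + 1 ≤ firstHit M ω := le_iInf₂ fun j hj => by
    have : t + 1 ≤ j := not_lt.1 fun hjt => h j (Nat.lt_succ_iff.1 hjt) hj
    exact_mod_cast this
  exact (ENNReal.lt_add_right (ENNReal.natCast_ne_top t) one_ne_zero).trans_le hle

theorem firstHit_consPath_of_mem {x : V} (hx : x ∈ M) (ω : ℕ → V) :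
    firstHit M (consPath x ω) = 0 :=
  le_antisymm (by simpa using firstHit_le (ω := consPath x ω) (t := 0) hx) zero_le

theorem firstHit_consPath_le (x : V) (ω : ℕ → V) :
    firstHit M (consPath x ω) ≤ 1 + firstHit M ω := by
  rw [firstHit.eq_def M ω, ENNReal.add_iInf₂]
  refine le_iInf₂ fun t ht => (firstHit_le (t := t + 1) ht).trans_eq ?_
  push_cast
  exact add_comm _ _

theorem dependsOn_min_firstHit (k : ℕ) :
    DependsOn (fun ω : ℕ → V => min (firstHit M ω) k) (Set.Iic k) := by
  have hle {ω ω' : ℕ → V} (h : ∀ t ∈ Set.Iic k, ω t = ω' t) :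
      min (firstHit M ω) k ≤ firstHit M ω' := le_iInf₂ fun t ht => by
    obtain htk | hkt := le_total t k
    · exact (min_le_left _ _).trans (firstHit_le (h t htk ▸ ht))
    · exact (min_le_right _ _).trans (by exact_mod_cast hkt)
  exact fun ω ω' h => le_antisymm (le_min (hle h) (min_le_right _ _))
    (le_min (hle fun t ht => (h t ht).symm) (min_le_right _ _))

/-- The times before `k` at which a trajectory visits `s`, before it hits `M`. -/
def visitsBefore (M : Finset V) (s : V) (k : ℕ) (ω : ℕ → V) : Set ℕ :=
  {t | t < k ∧ ω t = s ∧ ∀ j ≤ t, ω j ∉ M}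

/-- Whether a trajectory visits `s` before time `k` and before it hits `M`. -/
def visitIndicator (M : Finset V) (s : V) (k : ℕ) : (ℕ → V) → ℝ≥0∞ :=
  {ω | (visitsBefore M s k ω).Nonempty}.indicator 1

/-- The last exit from `s` before hitting `M`, as far as the states before time `k` tell. -/
def lastExitBefore (M : Finset V) (s : V) (k : ℕ) (ω : ℕ → V) : ℝ≥0∞ :=
  ⨆ t ∈ visitsBefore M s k ω, ((t : ℝ≥0∞) + 1)

variable (M) (s : V)

@[simp]
theorem visitsBefore_zero (ω : ℕ → V) : visitsBefore M s 0 ω = ∅ := by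
  simp [visitsBefore]

theorem dependsOn_visitsBefore (k : ℕ) : DependsOn (visitsBefore M s k) (Set.Iic k) :=
  fun ω ω' h => Set.ext fun t => and_congr_right fun ht => by
    rw [h t ht.le, forall₂_congr fun j hj => by rw [h j (hj.trans ht.le)]]

theorem dependsOn_visitIndicator (k : ℕ) : DependsOn (visitIndicator M s k) (Set.Iic k) := by
  classical
  intro ω ω' h
  simp only [visitIndicator, Set.indicator_apply, Set.mem_ofPred_eq,
    dependsOn_visitsBefore M s k h, Pi.one_apply]

theorem dependsOn_lastExitBefore (k : ℕ) :
    DependsOn (lastExitBefore M s k) (Set.Iic k) := fun ω ω' h => by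
  simp only [lastExitBefore, dependsOn_visitsBefore M s k h]

theorem visitsBefore_mono (ω : ℕ → V) : Monotone fun k => visitsBefore M s k ω :=
  fun _ _ hkl _ ht => ⟨ht.1.trans_le hkl, ht.2⟩

theorem lastExitBefore_mono : Monotone (lastExitBefore M s) :=
  fun _ _ hkl ω => biSup_mono (visitsBefore_mono M s ω hkl)

theorem lastExit_eq_iSup_lastExitBefore (ω : ℕ → V) :
    lastExit M s ω = ⨆ k, lastExitBefore M s k ω := by
  refine le_antisymm (iSup₂_le fun t ht => ?_) (iSup_le fun k => iSup₂_le fun t ht => ?_)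
  · exact le_iSup_of_le (t + 1) <| le_iSup₂_of_le t
      ⟨t.lt_succ_self, ht.2, natCast_lt_firstHit_iff.1 ht.1⟩ le_rfl
  · exact le_iSup₂_of_le t ⟨natCast_lt_firstHit_iff.2 ht.2.2, ht.2.1⟩ le_rfl

variable {M s}

theorem succ_mem_visitsBefore_consPath {k t : ℕ} {x : V} {ω : ℕ → V} :
    t + 1 ∈ visitsBefore M s (k + 1) (consPath x ω) ↔ x ∉ M ∧ t ∈ visitsBefore M s k ω := by
  simp only [visitsBefore, Set.mem_ofPred_eq, Nat.add_lt_add_iff_right, consPath_succ]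
  refine ⟨fun ⟨htk, hts, hM⟩ => ⟨hM 0 (Nat.zero_le _), htk, hts, fun j hj => hM (j + 1) (by omega)⟩,
    fun ⟨hx, htk, hts, hM⟩ => ⟨htk, hts, fun j hj => ?_⟩⟩
  cases j with
  | zero => exact hx
  | succ j => exact hM j (Nat.succ_le_succ_iff.1 hj)

theorem visitsBefore_consPath_of_mem {x : V} (hx : x ∈ M) (k : ℕ) (ω : ℕ → V) :
    visitsBefore M s k (consPath x ω) = ∅ :=
  Set.eq_empty_of_forall_notMem fun _ ht => ht.2.2 0 (Nat.zero_le _) hx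

theorem visitIndicator_consPath_le {x : V} (hxs : x ≠ s) (k : ℕ) (ω : ℕ → V) :
    visitIndicator M s (k + 1) (consPath x ω) ≤ visitIndicator M s k ω := by
  refine Set.indicator_apply_le' (fun ⟨t, ht⟩ => ?_) fun _ => zero_le
  obtain t | t := t
  · exact absurd (ht.2.1 : x = s) hxs
  · exact (Set.indicator_of_mem (s := {ω | (visitsBefore M s k ω).Nonempty})
      ⟨t, (succ_mem_visitsBefore_consPath.1 ht).2⟩ 1).ge

theorem lastExitBefore_consPath_le (k : ℕ) (x : V) (ω : ℕ → V) :
    lastExitBefore M s (k + 1) (consPath x ω) ≤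
      visitIndicator M s (k + 1) (consPath x ω) +
        lastExitBefore M s k ω := by
  refine iSup₂_le fun t ht => ?_
  have hvisit : visitIndicator M s (k + 1) (consPath x ω) = 1 :=
    Set.indicator_of_mem (s := {ω | (visitsBefore M s (k + 1) ω).Nonempty}) ⟨t, ht⟩ 1
  rw [hvisit, add_comm]
  gcongr
  cases t with
  | zero => simp
  | succ t =>
    push_cast
    exact le_iSup₂_of_le t (succ_mem_visitsBefore_consPath.1 ht).2 le_rfl

end Paths

variable {V : Type*} [Fintype V] [MeasurableSpace V] [DiscreteMeasurableSpace V]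
  {p : V → V → ℝ} {M : Finset V}

theorem lintegral_firstHit_le {φ : V → ℝ} (hp : ∀ x ∉ M, p x ∈ stdSimplex ℝ V)
    (hφ0 : ∀ x, 0 ≤ φ x) (hφ : ∀ x ∉ M, 1 + p x ⬝ᵥ φ ≤ φ x) (s : V) :
    ∫⁻ ω, firstHit M ω ∂chainLaw p s ≤ ENNReal.ofReal (φ s) := by
  have htruncated (k : ℕ) (x : V) :
      ∫⁻ ω, min (firstHit M ω) k ∂chainLaw p x ≤ ENNReal.ofReal (φ x) := by
    induction k generalizing x with
    | zero => simp
    | succ k ih =>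
      rw [lintegral_chainLaw_first_step p x (dependsOn_min_firstHit (k + 1))]
      by_cases hx : x ∈ M
      · simp [firstHit_consPath_of_mem hx]
      calc ∫⁻ y, ∫⁻ ω, min (firstHit M (consPath x ω)) (k + 1 : ℕ) ∂chainLaw p y ∂stepKernel p x
          ≤ ∫⁻ y, ∫⁻ ω, 1 + min (firstHit M ω) k ∂chainLaw p y ∂stepKernel p x := by
            gcongr with y ω
            rw [← min_add_add_left, Nat.cast_succ, add_comm (k : ℝ≥0∞)]
            exact min_le_min_right _ (firstHit_consPath_le x ω)
        _ ≤ ∫⁻ y, 1 + ENNReal.ofReal (φ y) ∂stepKernel p x := by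
            gcongr with y
            rw [lintegral_add_left measurable_const, lintegral_one, measure_univ]
            gcongr
            exact ih y
        _ = ENNReal.ofReal (1 + p x ⬝ᵥ φ) := by
            rw [lintegral_add_left measurable_const, lintegral_one, measure_univ,
              lintegral_stepKernel_ofReal (hp x hx) hφ0, ENNReal.ofReal_add zero_le_one
                (dotProduct_nonneg_of_nonneg (hp x hx).1 hφ0),
              ENNReal.ofReal_one]
        _ ≤ ENNReal.ofReal (φ x) := ENNReal.ofReal_le_ofReal (hφ x hx)
  have hsup (ω : ℕ → V) : firstHit M ω = ⨆ k : ℕ, min (firstHit M ω) k := by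
    rw [← inf_iSup_eq, ENNReal.iSup_natCast, inf_top_eq]
  rw [lintegral_congr hsup, lintegral_iSup
    (fun k => measurable_of_dependsOn_Iic (dependsOn_min_firstHit k))
    fun k l hkl ω => min_le_min_left _ (by exact_mod_cast hkl)]
  exact iSup_le fun k => htruncated k s

theorem lintegral_firstHit_le_of_one_le_mul_sum {A : ℝ} (hp : ∀ x ∉ M, p x ∈ stdSimplex ℝ V)
    (hA : ∀ x ∉ M, 1 ≤ A * ∑ a ∈ M, p x a) (s : V) :
    ∫⁻ ω, firstHit M ω ∂chainLaw p s ≤ ENNReal.ofReal A := by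
  classical
  let φ (x : V) : ℝ := if x ∈ M then 0 else A
  have hA0 {x : V} (hx : x ∉ M) : 0 ≤ A :=
    (pos_of_mul_pos_left (one_pos.trans_le (hA x hx))
      (Finset.sum_nonneg fun a _ => (hp x hx).1 a)).le
  have hφ0 (x : V) : 0 ≤ φ x := by
    by_cases hx : x ∈ M
    · simp [φ, hx]
    · simpa [φ, hx] using hA0 hx
  have hmean (x : V) (hx : x ∉ M) : p x ⬝ᵥ φ = A - A * ∑ a ∈ M, p x a := by
    have hterm (y : V) : p x y * φ y = A * p x y - if y ∈ M then A * p x y else 0 := by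
      by_cases hy : y ∈ M <;> simp [φ, hy, mul_comm]
    simp only [dotProduct, hterm, Finset.sum_sub_distrib, ← Finset.mul_sum, (hp x hx).2, mul_one,
      Finset.sum_ite_mem, Finset.univ_inter]
  refine (lintegral_firstHit_le hp hφ0 (fun x hx => ?_) s).trans ?_
  · have hφx : φ x = A := if_neg hx
    linarith [hmean x hx, hA x hx]
  · by_cases hs : s ∈ M <;> simp [φ, hs]

theorem lintegral_visitIndicator_le {s : V} {u : V → ℝ} (hp : ∀ x ∉ M, p x ∈ stdSimplex ℝ V)
    (hu0 : ∀ x, 0 ≤ u x) (hs : s ∉ M → 1 ≤ u s) (hu : ∀ x ∉ M, x ≠ s → p x ⬝ᵥ u ≤ u x)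
    (k : ℕ) (x : V) :
    ∫⁻ ω, visitIndicator M s k ω ∂chainLaw p x ≤ ENNReal.ofReal (u x) := by
  induction k generalizing x with
  | zero => simp [visitIndicator]
  | succ k ih =>
    by_cases hx : x ∈ M
    · rw [lintegral_chainLaw_first_step p x (dependsOn_visitIndicator M s (k + 1))]
      simp [visitIndicator, Set.indicator, visitsBefore_consPath_of_mem hx]
    obtain rfl | hxs := eq_or_ne x s
    · calc _ ≤ ∫⁻ _, 1 ∂chainLaw p x := lintegral_mono (Set.indicator_le_self _ _)
        _ ≤ ENNReal.ofReal (u x) := by simpa using ENNReal.ofReal_le_ofReal (hs hx)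
    rw [lintegral_chainLaw_first_step p x (dependsOn_visitIndicator M s (k + 1))]
    calc _ ≤ ∫⁻ y, ENNReal.ofReal (u y) ∂stepKernel p x := by
          gcongr with y
          refine (lintegral_mono fun ω => ?_).trans (ih y)
          exact visitIndicator_consPath_le hxs k ω
      _ = ENNReal.ofReal (p x ⬝ᵥ u) := lintegral_stepKernel_ofReal (hp x hx) hu0
      _ ≤ ENNReal.ofReal (u x) := ENNReal.ofReal_le_ofReal (hu x hx hxs)

theorem lintegral_lastExit_le {s : V} {u l : V → ℝ} (hp : ∀ x ∉ M, p x ∈ stdSimplex ℝ V)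
    (hu0 : ∀ x, 0 ≤ u x) (hl0 : ∀ x, 0 ≤ l x) (hs : s ∉ M → 1 ≤ u s)
    (hu : ∀ x ∉ M, x ≠ s → p x ⬝ᵥ u ≤ u x) (hl : ∀ x ∉ M, u x + p x ⬝ᵥ l ≤ l x) (x : V) :
    ∫⁻ ω, lastExit M s ω ∂chainLaw p x ≤ ENNReal.ofReal (l x) := by
  have htruncated (k : ℕ) (x : V) :
      ∫⁻ ω, lastExitBefore M s k ω ∂chainLaw p x ≤ ENNReal.ofReal (l x) := by
    induction k generalizing x with
    | zero => simp [lastExitBefore]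
    | succ k ih =>
      have hvisit := dependsOn_visitIndicator M s (k + 1)
      rw [lintegral_chainLaw_first_step p x (dependsOn_lastExitBefore M s (k + 1))]
      by_cases hx : x ∈ M
      · simp [lastExitBefore, visitsBefore_consPath_of_mem hx]
      calc _ ≤ ∫⁻ y, ∫⁻ ω, (visitIndicator M s (k + 1) (consPath x ω) +
              lastExitBefore M s k ω) ∂chainLaw p y ∂stepKernel p x := by
            gcongr with y ω
            exact lastExitBefore_consPath_le k x ω
        _ = ∫⁻ ω, visitIndicator M s (k + 1) ω ∂chainLaw p x +
              ∫⁻ y, ∫⁻ ω, lastExitBefore M s k ω ∂chainLaw p y ∂stepKernel p x := by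
            rw [lintegral_chainLaw_first_step p x hvisit, ← lintegral_add_left .of_discrete]
            exact lintegral_congr fun y => lintegral_add_left
              (measurable_of_dependsOn_Iic (dependsOn_comp_consPath hvisit x)) _
        _ ≤ ENNReal.ofReal (u x) + ∫⁻ y, ENNReal.ofReal (l y) ∂stepKernel p x := by
            gcongr with y
            · exact lintegral_visitIndicator_le hp hu0 hs hu (k + 1) x
            · exact ih y
        _ = ENNReal.ofReal (u x + p x ⬝ᵥ l) := by
            rw [lintegral_stepKernel_ofReal (hp x hx) hl0, ENNReal.ofReal_add (hu0 x)
              (dotProduct_nonneg_of_nonneg (hp x hx).1 hl0)]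
        _ ≤ ENNReal.ofReal (l x) := ENNReal.ofReal_le_ofReal (hl x hx)
  rw [lintegral_congr (lastExit_eq_iSup_lastExitBefore M s), lintegral_iSup
    (fun k => measurable_of_dependsOn_Iic (dependsOn_lastExitBefore M s k))
    (lastExitBefore_mono M s)]
  exact iSup_le fun k => htruncated k x

end Times

/-! ### The Laplacian of a weighted graph -/

namespace WeightedGraph

variable {V : Type*} [Fintype V] (G : WeightedGraph V)

theorem degree_nonneg (x : V) : 0 ≤ G.degree x := Finset.sum_nonneg fun y _ => G.nonneg x y

section Laplacian

/-- The graph Laplacian `L u x = ∑ y, w x y (u x - u y)`; the Dirichlet form of `u` and `v` is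
`u ⬝ᵥ L v`. -/
def laplacian : (V → ℝ) →ₗ[ℝ] V → ℝ where
  toFun u x := ∑ y, G.w x y * (u x - u y)
  map_add' u v := by
    funext x
    simp only [Pi.add_apply, ← Finset.sum_add_distrib]
    exact Finset.sum_congr rfl fun y _ => by ring
  map_smul' c u := by
    funext x
    simp only [Pi.smul_apply, smul_eq_mul, RingHom.id_apply, Finset.mul_sum]
    exact Finset.sum_congr rfl fun y _ => by ring

theorem laplacian_apply (u : V → ℝ) (x : V) :
    G.laplacian u x = ∑ y, G.w x y * (u x - u y) := rfl

theorem dotProduct_laplacian (u v : V → ℝ) :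
    u ⬝ᵥ G.laplacian v = 1 / 2 * ∑ x, ∑ y, G.w x y * ((u x - u y) * (v x - v y)) := by
  have hswap : ∑ x, ∑ y, G.w x y * (u y * (v x - v y)) =
      -∑ x, ∑ y, G.w x y * (u x * (v x - v y)) := by
    rw [Finset.sum_comm, ← Finset.sum_neg_distrib]
    refine Finset.sum_congr rfl fun x _ => ?_
    rw [← Finset.sum_neg_distrib]
    exact Finset.sum_congr rfl fun y _ => by rw [G.symm y x]; ring
  have hdot : u ⬝ᵥ G.laplacian v = ∑ x, ∑ y, G.w x y * (u x * (v x - v y)) :=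
    Finset.sum_congr rfl fun x _ => by
      rw [laplacian_apply, Finset.mul_sum]
      exact Finset.sum_congr rfl fun y _ => by ring
  simp only [sub_mul, mul_sub (G.w _ _), Finset.sum_sub_distrib] at hswap hdot ⊢
  linarith

theorem dotProduct_laplacian_comm (u v : V → ℝ) : u ⬝ᵥ G.laplacian v = v ⬝ᵥ G.laplacian u := by
  simp only [dotProduct_laplacian, mul_comm (u _ - u _)]

theorem dotProduct_laplacian_self_nonneg (u : V → ℝ) : 0 ≤ u ⬝ᵥ G.laplacian u := by
  rw [dotProduct_laplacian]
  exact mul_nonneg (by norm_num) <| Finset.sum_nonneg fun x _ => Finset.sum_nonneg fun y _ =>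
    mul_nonneg (G.nonneg x y) (mul_self_nonneg _)

theorem laplacian_const (c : ℝ) : G.laplacian (fun _ => c) = 0 := by
  funext x
  simp [laplacian_apply]

theorem sum_laplacian (u : V → ℝ) : ∑ x, G.laplacian u x = 0 := by
  rw [← one_dotProduct, dotProduct_laplacian_comm]
  simp [show (1 : V → ℝ) = fun _ => 1 from rfl, laplacian_const]

theorem dotProduct_laplacian_comp_le {φ : ℝ → ℝ} (hmono : Monotone φ)
    (hlip : ∀ a b, a ≤ b → φ b - φ a ≤ b - a) (u : V → ℝ) :
    (φ ∘ u) ⬝ᵥ G.laplacian (φ ∘ u) ≤ (φ ∘ u) ⬝ᵥ G.laplacian u := by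
  rw [dotProduct_laplacian, dotProduct_laplacian]
  gcongr 1 / 2 * ∑ x, ∑ y, ?_ with x _ y _
  refine mul_le_mul_of_nonneg_left ?_ (G.nonneg x y)
  simp only [Function.comp_apply]
  rcases le_total (u x) (u y) with h | h
  · nlinarith [hmono h, hlip _ _ h]
  · nlinarith [hmono h, hlip _ _ h]

/-- Twice the carré du champ of the Laplacian. -/
def sqGradient (u : V → ℝ) (x : V) : ℝ := ∑ y, G.w x y * (u x - u y) ^ 2

theorem sqGradient_nonneg (u : V → ℝ) (x : V) : 0 ≤ G.sqGradient u x :=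
  Finset.sum_nonneg fun y _ => mul_nonneg (G.nonneg x y) (sq_nonneg _)

theorem sq_laplacian_le (u : V → ℝ) (x : V) :
    G.laplacian u x ^ 2 ≤ G.degree x * G.sqGradient u x :=
  Finset.sum_sq_le_sum_mul_sum_of_sq_le_mul _ (fun y _ => G.nonneg x y)
    (fun y _ => mul_nonneg (G.nonneg x y) (sq_nonneg _)) fun y _ => (by ring : _ = _).le

theorem dotProduct_sqGradient (φ u : V → ℝ) :
    φ ⬝ᵥ G.sqGradient u = 2 * ((φ * u) ⬝ᵥ G.laplacian u) - (u ^ 2) ⬝ᵥ G.laplacian φ := by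
  have hswap : ∑ x, ∑ y, G.w x y * (φ y * (u x - u y) ^ 2) =
      ∑ x, ∑ y, G.w x y * (φ x * (u x - u y) ^ 2) := by
    rw [Finset.sum_comm]
    refine Finset.sum_congr rfl fun x _ => Finset.sum_congr rfl fun y _ => ?_
    rw [G.symm y x]
    ring
  have hdot : φ ⬝ᵥ G.sqGradient u = ∑ x, ∑ y, G.w x y * (φ x * (u x - u y) ^ 2) :=
    Finset.sum_congr rfl fun x _ => by
      rw [sqGradient, Finset.mul_sum]
      exact Finset.sum_congr rfl fun y _ => by ring
  calc φ ⬝ᵥ G.sqGradient u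
      = 1 / 2 * (∑ x, ∑ y, G.w x y * (φ x * (u x - u y) ^ 2) +
          ∑ x, ∑ y, G.w x y * (φ y * (u x - u y) ^ 2)) := by rw [hdot, hswap]; ring
    _ = 2 * ((φ * u) ⬝ᵥ G.laplacian u) - (u ^ 2) ⬝ᵥ G.laplacian φ := by
        simp only [dotProduct_laplacian, ← Finset.sum_add_distrib, Finset.mul_sum,
          ← Finset.sum_sub_distrib, Pi.mul_apply, Pi.pow_apply]
        exact Finset.sum_congr rfl fun x _ => Finset.sum_congr rfl fun y _ => by ring

end Laplacian

section Dirichlet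

/-- The sink `M` meets every connected component of `G`, expressed through the Dirichlet form: a
function that vanishes on `M` and is locally constant is zero. -/
def IsGrounded (M : Finset V) : Prop :=
  ∀ u : V → ℝ, (∀ x ∈ M, u x = 0) → u ⬝ᵥ G.laplacian u = 0 → u = 0

/-- `u` solves the Poisson equation `L u = g` off `M`, with zero boundary values on `M`. -/
structure IsDirichletSolution (M : Finset V) (g u : V → ℝ) : Prop where
  eq_zero : ∀ x ∈ M, u x = 0
  laplacian_eq : ∀ x ∉ M, G.laplacian u x = g x

variable {G} {M : Finset V} {g g' u u' : V → ℝ}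

theorem IsDirichletSolution.dotProduct_laplacian_eq (hu : G.IsDirichletSolution M g u)
    {ψ : V → ℝ} (hψ : ∀ x ∈ M, ψ x = 0) : ψ ⬝ᵥ G.laplacian u = ψ ⬝ᵥ g :=
  Finset.sum_congr rfl fun x _ => by
    by_cases hx : x ∈ M
    · simp [hψ x hx]
    · rw [hu.laplacian_eq x hx]

theorem IsDirichletSolution.reciprocity (hu : G.IsDirichletSolution M g u)
    (hu' : G.IsDirichletSolution M g' u') : u ⬝ᵥ g' = u' ⬝ᵥ g := by
  rw [← hu'.dotProduct_laplacian_eq hu.eq_zero, ← hu.dotProduct_laplacian_eq hu'.eq_zero,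
    G.dotProduct_laplacian_comm]

theorem IsDirichletSolution.sum_laplacian_sink [DecidableEq V]
    (hu : G.IsDirichletSolution M g u) : ∑ a ∈ M, G.laplacian u a = -∑ x ∈ Mᶜ, g x := by
  rw [← Finset.sum_congr rfl fun x hx => hu.laplacian_eq x (Finset.mem_compl.1 hx),
    eq_neg_iff_add_eq_zero, Finset.sum_add_sum_compl, G.sum_laplacian]

theorem IsGrounded.exists_isDirichletSolution (hM : G.IsGrounded M) (g : V → ℝ) :
    ∃ u, G.IsDirichletSolution M g u := by
  classical
  let T : (V → ℝ) →ₗ[ℝ] V → ℝ :=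
    LinearMap.pi fun x => if x ∈ M then LinearMap.proj x else LinearMap.proj x ∘ₗ G.laplacian
  have hT (u : V → ℝ) : T u = M.piecewise u (G.laplacian u) := by
    funext x
    by_cases hx : x ∈ M <;> simp [T, hx]
  have hsol {u g : V → ℝ} (hu : T u = M.piecewise (0 : V → ℝ) g) : G.IsDirichletSolution M g u := by
    have hx (x : V) := congrFun ((hT u).symm.trans hu) x
    exact ⟨fun x hxM => by simpa [hxM] using hx x, fun x hxM => by simpa [hxM] using hx x⟩
  have hT_inj : Function.Injective T := (injective_iff_map_eq_zero T).2 fun u hu => by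
    have hu0 : G.IsDirichletSolution M 0 u := hsol (by rw [hu, Finset.piecewise_same])
    exact hM u hu0.eq_zero (by rw [hu0.dotProduct_laplacian_eq hu0.eq_zero, dotProduct_zero])
  obtain ⟨u, hu⟩ := LinearMap.injective_iff_surjective.1 hT_inj (M.piecewise (0 : V → ℝ) g)
  exact ⟨u, hsol hu⟩

theorem IsDirichletSolution.nonneg (hM : G.IsGrounded M) (hu : G.IsDirichletSolution M g u)
    (hg : ∀ x ∉ M, 0 ≤ g x) (x : V) : 0 ≤ u x := by
  let negPart (a : ℝ) : ℝ := min a 0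
  have hboundary (y : V) (hy : y ∈ M) : negPart (u y) = 0 := by
    rw [hu.eq_zero y hy]
    exact min_self 0
  have henergy : (negPart ∘ u) ⬝ᵥ G.laplacian (negPart ∘ u) ≤ 0 :=
    calc _ ≤ (negPart ∘ u) ⬝ᵥ G.laplacian u :=
          G.dotProduct_laplacian_comp_le (fun a b hab => min_le_min_right 0 hab)
            (fun a b hab => by grind) u
      _ = (negPart ∘ u) ⬝ᵥ g := hu.dotProduct_laplacian_eq hboundary
      _ ≤ 0 := Finset.sum_nonpos fun y _ => by
          by_cases hy : y ∈ M
          · rw [Function.comp_apply, hboundary y hy, zero_mul]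
          · exact mul_nonpos_of_nonpos_of_nonneg (min_le_right _ _) (hg y hy)
  have hzero : negPart ∘ u = 0 :=
    hM _ hboundary (henergy.antisymm (G.dotProduct_laplacian_self_nonneg _))
  exact min_eq_right_iff.1 (congrFun hzero x)

theorem IsDirichletSolution.nonneg_of_single [DecidableEq V] {x : V} {v : V → ℝ}
    (hM : G.IsGrounded M) (hv : G.IsDirichletSolution M (Pi.single x 1) v) (y : V) : 0 ≤ v y :=
  hv.nonneg hM (fun z _ => (Pi.single_nonneg.2 zero_le_one : (0 : V → ℝ) ≤ Pi.single x 1) z) y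

theorem IsDirichletSolution.one_le_degree_mul [DecidableEq V] {x : V} {v : V → ℝ}
    (hM : G.IsGrounded M) (hv : G.IsDirichletSolution M (Pi.single x 1) v) (hx : x ∉ M) :
    1 ≤ G.degree x * v x := by
  have hv0 := hv.nonneg_of_single hM
  calc 1 = ∑ y, G.w x y * (v x - v y) := by
        rw [← G.laplacian_apply, hv.laplacian_eq x hx, Pi.single_eq_same]
    _ ≤ ∑ y, G.w x y * v x := by
        gcongr with y
        · exact G.nonneg x y
        · exact sub_le_self _ (hv0 y)
    _ = G.degree x * v x := by rw [degree, Finset.sum_mul]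

theorem IsGrounded.degree_pos (hM : G.IsGrounded M) {x : V} (hx : x ∉ M) : 0 < G.degree x := by
  classical
  obtain ⟨v, hv⟩ := hM.exists_isDirichletSolution (Pi.single x 1)
  have hdv := hv.one_le_degree_mul hM hx
  have hd := G.degree_nonneg x
  exact hd.lt_of_ne fun h => by rw [← h] at hdv; linarith

theorem IsDirichletSolution.self_pos [DecidableEq V] {x : V} {v : V → ℝ}
    (hM : G.IsGrounded M) (hv : G.IsDirichletSolution M (Pi.single x 1) v) (hx : x ∉ M) :
    0 < v x :=
  pos_of_mul_pos_right (one_pos.trans_le (hv.one_le_degree_mul hM hx)) (G.degree_nonneg x)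

end Dirichlet

/-! ### Electric flows -/

section ElectricFlow

variable {G} {M : Finset V} {x : V} {g : V → V → ℝ} {v : V → ℝ}

variable (G) in
theorem energy_nonneg (g : V → V → ℝ) : 0 ≤ G.energy g :=
  mul_nonneg (by norm_num) <| Finset.sum_nonneg fun y _ => Finset.sum_nonneg fun z _ =>
    div_nonneg (sq_nonneg _) (G.nonneg y z)

theorem eq_zero_of_energy_eq_zero (hsupp : ∀ y z, G.w y z = 0 → g y z = 0)
    (hg : G.energy g = 0) : g = 0 := by
  have hterm (y z : V) : 0 ≤ g y z ^ 2 / G.w y z := div_nonneg (sq_nonneg _) (G.nonneg y z)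
  have hsum : ∑ y, ∑ z, g y z ^ 2 / G.w y z = 0 := by
    simpa [energy] using hg
  funext y z
  rw [Finset.sum_eq_zero_iff_of_nonneg fun y _ => Finset.sum_nonneg fun z _ => hterm y z] at hsum
  have hyz := (Finset.sum_eq_zero_iff_of_nonneg fun z _ => hterm y z).1
    (hsum y (Finset.mem_univ y)) z (Finset.mem_univ z)
  rcases div_eq_zero_iff.1 hyz with h | h
  · exact pow_eq_zero_iff two_ne_zero |>.1 h
  · exact hsupp y z h

theorem IsUnitFlow.sum_sink (hg : G.IsUnitFlow x M g) : ∑ a ∈ M, ∑ y, g a y = -1 := by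
  rw [← hg.sink, ← Finset.sum_neg_distrib]
  refine Finset.sum_congr rfl fun a _ => ?_
  rw [← Finset.sum_neg_distrib]
  exact Finset.sum_congr rfl fun y _ => hg.antisymm a y

theorem sum_sum_eq_zero_of_antisymm (hg : ∀ y z, g y z = -g z y) : ∑ y, ∑ z, g y z = 0 := by
  have hswap : ∑ y, ∑ z, g y z = -∑ y, ∑ z, g y z := by
    conv_lhs => rw [Finset.sum_comm]
    simp only [← Finset.sum_neg_distrib]
    exact Finset.sum_congr rfl fun y _ => Finset.sum_congr rfl fun z _ => hg z y
  linarith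

theorem IsUnitFlow.notMem (hg : G.IsUnitFlow x M g) : x ∉ M := fun hx => by
  classical
  have htotal := sum_sum_eq_zero_of_antisymm hg.antisymm
  rw [← Finset.sum_add_sum_compl M, hg.sum_sink,
    Finset.sum_eq_zero fun y hy => hg.conserved y
      (fun h => Finset.mem_compl.1 hy (h ▸ hx)) (Finset.mem_compl.1 hy)] at htotal
  norm_num at htotal

theorem IsUnitFlow.half_sum_potential_sub (hg : G.IsUnitFlow x M g) (hv : ∀ a ∈ M, v a = 0) :
    1 / 2 * ∑ y, ∑ z, (v y - v z) * g y z = v x := by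
  have hswap : ∑ y, ∑ z, v z * g y z = -∑ y, ∑ z, v y * g y z := by
    rw [Finset.sum_comm]
    simp only [← Finset.sum_neg_distrib]
    exact Finset.sum_congr rfl fun y _ => Finset.sum_congr rfl fun z _ => by
      rw [hg.antisymm z y]; ring
  have hdiv : ∑ y, ∑ z, v y * g y z = v x := by
    simp only [← Finset.mul_sum]
    rw [Finset.sum_eq_single_of_mem x (Finset.mem_univ x), hg.source, mul_one]
    intro y _ hyx
    by_cases hy : y ∈ M
    · rw [hv y hy, zero_mul]
    · rw [hg.conserved y hyx hy, mul_zero]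
  simp only [sub_mul, Finset.sum_sub_distrib, hswap, hdiv]
  ring

variable (G) in
/-- The current driven by the potential `v` (Ohm's law). -/
def current (v : V → ℝ) (y z : V) : ℝ := G.w y z * (v y - v z)

theorem isUnitFlow_current [DecidableEq V] (hv : G.IsDirichletSolution M (Pi.single x 1) v)
    (hx : x ∉ M) : G.IsUnitFlow x M (G.current v) where
  supported y z h := by rw [current, h, zero_mul]
  antisymm y z := by rw [current, current, G.symm y z]; ring
  source := (hv.laplacian_eq x hx).trans (Pi.single_eq_same x 1)
  sink := by
    have hM : ∑ a ∈ M, ∑ y, G.current v y a = -∑ a ∈ M, G.laplacian v a := by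
      simp only [laplacian_apply, ← Finset.sum_neg_distrib]
      exact Finset.sum_congr rfl fun a _ => Finset.sum_congr rfl fun y _ => by
        rw [current, G.symm y a]; ring
    rw [hM, hv.sum_laplacian_sink]
    simp [hx]
  conserved y hyx hy := (hv.laplacian_eq y hy).trans (Pi.single_eq_of_ne hyx 1)

theorem IsUnitFlow.energy_eq [DecidableEq V] (hv : G.IsDirichletSolution M (Pi.single x 1) v)
    (hg : G.IsUnitFlow x M g) : G.energy g = v x + G.energy (g - G.current v) := by
  have hterm (y z : V) : g y z ^ 2 / G.w y z = 2 * ((v y - v z) * g y z) -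
      (v y - v z) * G.current v y z + (g - G.current v) y z ^ 2 / G.w y z := by
    simp only [Pi.sub_apply, current]
    rcases eq_or_ne (G.w y z) 0 with h | h
    · simp [h, hg.supported y z h]
    · field_simp
      ring
  have hg_pairing := hg.half_sum_potential_sub hv.eq_zero
  have hc_pairing := (isUnitFlow_current hv hg.notMem).half_sum_potential_sub hv.eq_zero
  simp only [energy, hterm, Finset.sum_add_distrib, Finset.sum_sub_distrib, ← Finset.mul_sum]
  linarith

theorem energy_current [DecidableEq V] (hv : G.IsDirichletSolution M (Pi.single x 1) v)
    (hx : x ∉ M) : G.energy (G.current v) = v x := by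
  rw [(isUnitFlow_current hv hx).energy_eq hv, sub_self]
  simp [energy]

theorem electricFlow_eq_current [DecidableEq V] (hv : G.IsDirichletSolution M (Pi.single x 1) v)
    (hx : x ∉ M) : G.electricFlow x M = G.current v := by
  have hexists : ∃ f, G.IsElectricFlow x M f := ⟨G.current v, isUnitFlow_current hv hx,
    fun g hg => by
      rw [energy_current hv hx, hg.energy_eq hv]
      exact le_add_of_nonneg_right (G.energy_nonneg _)⟩
  obtain ⟨hflow, hmin⟩ := hexists.choose_spec
  have hle := hmin _ (isUnitFlow_current hv hx)
  rw [energy_current hv hx, hflow.energy_eq hv] at hle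
  rw [electricFlow, dif_pos hexists, ← sub_eq_zero]
  refine eq_zero_of_energy_eq_zero (fun y z h => ?_)
    (le_antisymm (by linarith) (G.energy_nonneg _))
  rw [Pi.sub_apply, Pi.sub_apply, hflow.supported y z h, current, h, zero_mul, sub_zero]

theorem effectiveResistance_eq [DecidableEq V] (hv : G.IsDirichletSolution M (Pi.single x 1) v) :
    G.effectiveResistance M x = v x := by
  rw [effectiveResistance]
  by_cases hx : x ∈ M
  · rw [electricFlow, dif_neg fun ⟨_, hf⟩ => hf.1.notMem hx, hv.eq_zero x hx]
    simp [energy]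
  · rw [electricFlow_eq_current hv hx, energy_current hv hx]

end ElectricFlow

/-! ### The random walk and the elfs process -/

variable {G} {M : Finset V}

section TransitionProbabilities

theorem walkProb_mem_stdSimplex {x : V} (hx : 0 < G.degree x) :
    G.walkProb x ∈ stdSimplex ℝ V :=
  ⟨fun y => div_nonneg (G.nonneg x y) hx.le, by
    simp only [walkProb, ← Finset.sum_div]
    exact div_self hx.ne'⟩

theorem walkProb_dotProduct {x : V} (hx : 0 < G.degree x) (u : V → ℝ) :
    G.walkProb x ⬝ᵥ u = u x - G.laplacian u x / G.degree x := by
  have hlaplacian : G.laplacian u x = G.degree x * u x - G.degree x * (G.walkProb x ⬝ᵥ u) := by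
    rw [laplacian_apply, dotProduct, Finset.mul_sum, degree, Finset.sum_mul,
      ← Finset.sum_sub_distrib]
    refine Finset.sum_congr rfl fun y _ => ?_
    rw [walkProb, ← degree]
    field_simp
  rw [hlaplacian]
  field_simp
  ring

variable [DecidableEq V] {x : V} {v : V → ℝ}

theorem elfsProb_eq (hv : G.IsDirichletSolution M (Pi.single x 1) v) (hx : x ∉ M) (y : V) :
    G.elfsProb M x y = G.sqGradient v y / (2 * v x) := by
  have hterm (z : V) : G.current v y z ^ 2 / G.w y z = G.w y z * (v y - v z) ^ 2 := by
    rcases eq_or_ne (G.w y z) 0 with h | h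
    · simp [current, h]
    · rw [current]
      field_simp
  rw [elfsProb, effectiveResistance_eq hv, electricFlow_eq_current hv hx,
    Finset.sum_congr rfl fun z _ => hterm z, one_div_mul_eq_div, sqGradient]

theorem elfsProb_dotProduct (hM : G.IsGrounded M)
    (hv : G.IsDirichletSolution M (Pi.single x 1) v) (hx : x ∉ M) (φ : V → ℝ) :
    G.elfsProb M x ⬝ᵥ φ = φ x - (v ^ 2) ⬝ᵥ G.laplacian φ / (2 * v x) := by
  have hvx := hv.self_pos hM hx
  have hpairing : (φ * v) ⬝ᵥ G.laplacian v = φ x * v x := by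
    rw [hv.dotProduct_laplacian_eq fun a ha => by simp [hv.eq_zero a ha],
      dotProduct_single_one, Pi.mul_apply]
  have hgradient : G.elfsProb M x ⬝ᵥ φ = φ ⬝ᵥ G.sqGradient v / (2 * v x) := by
    rw [dotProduct_comm, dotProduct, dotProduct, Finset.sum_div]
    exact Finset.sum_congr rfl fun y _ => by rw [elfsProb_eq hv hx, mul_div_assoc]
  rw [hgradient, dotProduct_sqGradient, hpairing]
  field_simp

omit [DecidableEq V] in
theorem elfsProb_mem_stdSimplex (hM : G.IsGrounded M) (hx : x ∉ M) :
    G.elfsProb M x ∈ stdSimplex ℝ V := by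
  classical
  obtain ⟨v, hv⟩ := hM.exists_isDirichletSolution (Pi.single x 1)
  refine ⟨fun y => ?_, ?_⟩
  · rw [elfsProb_eq hv hx]
    exact div_nonneg (G.sqGradient_nonneg v y) (mul_pos two_pos (hv.self_pos hM hx)).le
  · rw [← dotProduct_one, elfsProb_dotProduct hM hv hx]
    simp [Pi.one_def, laplacian_const]

theorem one_le_elfsProb_sink (hM : G.IsGrounded M)
    (hv : G.IsDirichletSolution M (Pi.single x 1) v) (hx : x ∉ M) :
    1 ≤ 2 * v x * (∑ a ∈ M, G.degree a) * ∑ a ∈ M, G.elfsProb M x a := by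
  have hvx := hv.self_pos hM hx
  calc 1 = (∑ a ∈ M, G.laplacian v a) ^ 2 := by rw [hv.sum_laplacian_sink]; simp [hx]
    _ ≤ (∑ a ∈ M, G.degree a) * ∑ a ∈ M, G.sqGradient v a :=
        Finset.sum_sq_le_sum_mul_sum_of_sq_le_mul M (fun a _ => G.degree_nonneg a)
          (fun a _ => G.sqGradient_nonneg v a) fun a _ => G.sq_laplacian_le v a
    _ = 2 * v x * (∑ a ∈ M, G.degree a) * ∑ a ∈ M, G.elfsProb M x a := by
        simp only [elfsProb_eq hv hx, ← Finset.sum_div]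
        field_simp

end TransitionProbabilities

section Times

variable [MeasurableSpace V] [DiscreteMeasurableSpace V] {h : V → ℝ}

theorem hittingTime_le (hM : G.IsGrounded M) (hh : G.IsDirichletSolution M G.degree h) (x : V) :
    G.hittingTime M x ≤ ENNReal.ofReal (h x) := by
  refine lintegral_firstHit_le (fun y hy => walkProb_mem_stdSimplex (hM.degree_pos hy))
    (hh.nonneg hM fun y _ => G.degree_nonneg y) (fun y hy => ?_) x
  have hdy := hM.degree_pos hy
  rw [walkProb_dotProduct hdy, hh.laplacian_eq y hy, div_self hdy.ne', add_sub_cancel]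

theorem escapeTime_le [DecidableEq V] {x : V} {v : V → ℝ} (hM : G.IsGrounded M)
    (hv : G.IsDirichletSolution M (Pi.single x 1) v) :
    G.escapeTime M x ≤ ENNReal.ofReal (G.degree ⬝ᵥ v ^ 2 / v x) := by
  have hv0 := hv.nonneg_of_single hM
  let u : V → ℝ := (v x)⁻¹ • v
  have hu0 (y : V) : 0 ≤ u y := mul_nonneg (inv_nonneg.2 (hv0 x)) (hv0 y)
  obtain ⟨l, hl⟩ := hM.exists_isDirichletSolution (G.degree * u)
  have hlx : l x = G.degree ⬝ᵥ v ^ 2 / v x := by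
    rw [← dotProduct_single_one l x, hl.reciprocity hv, dotProduct, dotProduct, Finset.sum_div]
    refine Finset.sum_congr rfl fun y _ => ?_
    simp only [u, Pi.mul_apply, Pi.smul_apply, Pi.pow_apply, smul_eq_mul]
    ring
  rw [← hlx]
  refine lintegral_lastExit_le (u := u)
    (fun y hy => walkProb_mem_stdSimplex (hM.degree_pos hy)) hu0
    (hl.nonneg hM fun y _ => mul_nonneg (G.degree_nonneg y) (hu0 y))
    (fun hx => (inv_mul_cancel₀ (hv.self_pos hM hx).ne').ge)
    (fun y hy hyx => ?_) (fun y hy => ?_) x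
  · rw [walkProb_dotProduct (hM.degree_pos hy), map_smul, Pi.smul_apply, hv.laplacian_eq y hy,
      Pi.single_eq_of_ne hyx, smul_zero, zero_div, sub_zero]
  · have hdy := hM.degree_pos hy
    rw [walkProb_dotProduct hdy, hl.laplacian_eq y hy, Pi.mul_apply,
      mul_div_cancel_left₀ _ hdy.ne', add_sub_cancel]

theorem electricHittingTime_le_two_mul (hM : G.IsGrounded M)
    (hh : G.IsDirichletSolution M G.degree h) (x : V) :
    G.electricHittingTime M x ≤ ENNReal.ofReal (2 * h x) := by
  classical
  have hh0 := hh.nonneg hM fun y _ => G.degree_nonneg y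
  refine lintegral_firstHit_le (φ := (2 : ℝ) • h)
    (fun y hy => elfsProb_mem_stdSimplex hM hy)
    (fun y => mul_nonneg two_pos.le (hh0 y)) (fun y hy => ?_) x
  obtain ⟨v, hv⟩ := hM.exists_isDirichletSolution (Pi.single y 1)
  have hvy := hv.self_pos hM hy
  have hdrift : v y ≤ (v ^ 2) ⬝ᵥ G.laplacian h :=
    calc v y ≤ G.degree y * v y * v y := le_mul_of_one_le_left hvy.le (hv.one_le_degree_mul hM hy)
      _ = v y ^ 2 * G.degree y := by ring
      _ ≤ (v ^ 2) ⬝ᵥ G.degree := Finset.single_le_sum (f := fun z => (v ^ 2) z * G.degree z)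
          (fun z _ => mul_nonneg (sq_nonneg _) (G.degree_nonneg z)) (Finset.mem_univ y)
      _ = (v ^ 2) ⬝ᵥ G.laplacian h :=
          (hh.dotProduct_laplacian_eq fun a ha => by simp [hv.eq_zero a ha]).symm
  rw [elfsProb_dotProduct hM hv hy, map_smul, dotProduct_smul, Pi.smul_apply, smul_eq_mul,
    smul_eq_mul, mul_div_mul_left _ _ two_ne_zero]
  linarith [(one_le_div hvy).2 hdrift]

theorem electricHittingTime_le_of_effectiveResistance_le {R : ℝ} (hM : G.IsGrounded M)
    (hR : ∀ x, G.effectiveResistance M x ≤ R) (x : V) :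
    G.electricHittingTime M x ≤ ENNReal.ofReal (2 * R * ∑ a ∈ M, G.degree a) := by
  classical
  refine lintegral_firstHit_le_of_one_le_mul_sum (fun y hy => elfsProb_mem_stdSimplex hM hy)
    (fun y hy => ?_) x
  obtain ⟨v, hv⟩ := hM.exists_isDirichletSolution (Pi.single y 1)
  refine (one_le_elfsProb_sink hM hv hy).trans ?_
  rw [← effectiveResistance_eq hv]
  gcongr
  · exact Finset.sum_nonneg fun a _ => (elfsProb_mem_stdSimplex hM hy).1 a
  · exact Finset.sum_nonneg fun a _ => G.degree_nonneg a
  · exact hR y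

end Times

end WeightedGraph

/-! ### The Poincaré inequality -/

section Balance

variable {V : Type*} [Fintype V]

theorem sum_sq_eq_sum_sq_balance_add (f : V → ℝ) :
    ∑ x, f x ^ 2 = ∑ x, Fintype.balance f x ^ 2 + Fintype.card V * (𝔼 x, f x) ^ 2 := by
  have hterm (x : V) : f x ^ 2 =
      Fintype.balance f x ^ 2 + 2 * (𝔼 y, f y) * Fintype.balance f x + (𝔼 y, f y) ^ 2 := by
    rw [Fintype.balance_apply]
    ring
  simp only [hterm, Finset.sum_add_distrib, ← Finset.mul_sum, Fintype.sum_balance, mul_zero,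
    add_zero, Finset.sum_const, Finset.card_univ, nsmul_eq_mul]

theorem card_mul_sq_expect_le {S : Finset V} {f : V → ℝ} (hf : ∀ x ∈ S, f x = 0) :
    S.card * (𝔼 x, f x) ^ 2 ≤ ∑ x, Fintype.balance f x ^ 2 :=
  calc S.card * (𝔼 x, f x) ^ 2 = ∑ x ∈ S, Fintype.balance f x ^ 2 := by
        rw [Finset.sum_congr rfl fun x hx => by
          rw [Fintype.balance_apply, hf x hx, zero_sub, neg_sq], Finset.sum_const, nsmul_eq_mul]
    _ ≤ ∑ x, Fintype.balance f x ^ 2 :=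
        Finset.sum_le_univ_sum_of_nonneg fun x => sq_nonneg _

theorem sq_sub_le_two_mul_sum_sq_balance (f : V → ℝ) (x y : V) :
    (f x - f y) ^ 2 ≤ 2 * ∑ z, Fintype.balance f z ^ 2 := by
  classical
  obtain rfl | hxy := eq_or_ne x y
  · rw [sub_self, sq, zero_mul]
    positivity
  calc (f x - f y) ^ 2 = (Fintype.balance f x - Fintype.balance f y) ^ 2 := by
        rw [Fintype.balance_apply, Fintype.balance_apply, sub_sub_sub_cancel_right]
    _ ≤ 2 * (Fintype.balance f x ^ 2 + Fintype.balance f y ^ 2) := by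
        linarith [sq_nonneg (Fintype.balance f x + Fintype.balance f y)]
    _ = 2 * ∑ z ∈ {x, y}, Fintype.balance f z ^ 2 := by rw [Finset.sum_pair hxy]
    _ ≤ 2 * ∑ z, Fintype.balance f z ^ 2 := by
        gcongr
        exact Finset.subset_univ _

theorem card_le_two_mul_card_filter_le {f : V → ℝ} (hf : ∀ x, 0 ≤ f x) {a : ℝ} (ha : 0 < a)
    (hmean : 2 * 𝔼 x, f x ≤ a) : (Fintype.card V : ℝ) ≤ 2 * ({x | f x ≤ a} : Finset V).card := by
  have hmarkov : ({x | a < f x} : Finset V).card * a ≤ Fintype.card V * 𝔼 x, f x := by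
    rw [Fintype.card_mul_expect, ← nsmul_eq_mul]
    exact (Finset.card_nsmul_le_sum _ f a fun x hx => (Finset.mem_filter.1 hx).2.le).trans
      (Finset.sum_le_univ_sum_of_nonneg hf)
  have hsplit : (Fintype.card V : ℝ) =
      ({x | f x ≤ a} : Finset V).card + ({x | a < f x} : Finset V).card := by
    simp only [← not_le (a := f _)]
    exact_mod_cast (Finset.card_filter_add_card_filter_not (s := Finset.univ) (f · ≤ a)).symm
  have hfew : 2 * (({x | a < f x} : Finset V).card : ℝ) ≤ Fintype.card V := by
    refine le_of_mul_le_mul_right ?_ ha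
    linarith [mul_le_mul_of_nonneg_left hmean (Nat.cast_nonneg (α := ℝ) (Fintype.card V))]
  linarith

end Balance

open scoped InnerProductSpace in
theorem mul_norm_sq_le_inner_of_forall_hasEigenvalue {E : Type*} [NormedAddCommGroup E]
    [InnerProductSpace ℝ E] [FiniteDimensional ℝ E] {T : E →ₗ[ℝ] E} (hT : T.IsSymmetric) {c : ℝ}
    (hc : ∀ μ, Module.End.HasEigenvalue T μ → c ≤ μ) (x : E) : c * ‖x‖ ^ 2 ≤ ⟪T x, x⟫_ℝ := by
  let b := hT.eigenvectorBasis rfl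
  have hTb (i) : ⟪T x, b i⟫_ℝ = hT.eigenvalues rfl i * ⟪x, b i⟫_ℝ := by
    rw [hT x (b i), hT.apply_eigenvectorBasis rfl i, inner_smul_right]
    rfl
  calc c * ‖x‖ ^ 2 = ∑ i, c * ⟪x, b i⟫_ℝ ^ 2 := by
        rw [← real_inner_self_eq_norm_sq, ← b.sum_inner_mul_inner x x, Finset.mul_sum]
        exact Finset.sum_congr rfl fun i _ => by rw [real_inner_comm x, sq]
    _ ≤ ∑ i, hT.eigenvalues rfl i * ⟪x, b i⟫_ℝ ^ 2 := by
        gcongr with i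
        exact hc _ (hT.hasEigenvalue_eigenvalues rfl i)
    _ = ⟪T x, x⟫_ℝ := by
        rw [← b.sum_inner_mul_inner (T x) x]
        exact Finset.sum_congr rfl fun i _ => by rw [hTb, real_inner_comm x]; ring

theorem sq_log_le_four_mul {t : ℝ} (ht : 1 ≤ t) : Real.log t ^ 2 ≤ 4 * t := by
  have hsqrt := Real.log_le_sub_one_of_pos (Real.sqrt_pos.2 (one_pos.trans_le ht))
  rw [Real.log_sqrt (by positivity)] at hsqrt
  calc Real.log t ^ 2 ≤ (2 * √t) ^ 2 := by
        gcongr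
        · exact Real.log_nonneg ht
        · linarith
    _ = 4 * t := by rw [mul_pow, Real.sq_sqrt (by positivity)]; norm_num

theorem sq_div_add_log_div_le {n m : ℝ} (hn : 1 ≤ n) :
    (n / m + Real.log n) ^ 2 / n ≤ 8 * (1 + n / m ^ 2) := by
  have hn0 : 0 < n := one_pos.trans_le hn
  rw [div_le_iff₀ hn0]
  calc (n / m + Real.log n) ^ 2 ≤ 2 * ((n / m) ^ 2 + Real.log n ^ 2) := add_sq_le
    _ ≤ 2 * ((n / m) ^ 2 + 4 * n) := by
        gcongr
        exact sq_log_le_four_mul hn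
    _ ≤ 8 * (n + (n / m) ^ 2) := by linarith [sq_nonneg (n / m)]
    _ = 8 * (1 + n / m ^ 2) * n := by ring

namespace WeightedGraph

variable {V : Type*} [Fintype V] {G : WeightedGraph V} {M : Finset V} {κ : ℝ}

variable (G) in
/-- The Poincaré inequality with constant `κ`: the Laplacian is at least `κ` on the functions of
mean zero, or equivalently, the algebraic connectivity of `G` is at least `κ`. -/
def HasPoincare (κ : ℝ) : Prop :=
  ∀ f : V → ℝ, κ * ∑ x, Fintype.balance f x ^ 2 ≤ f ⬝ᵥ G.laplacian f

variable (G) in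
theorem laplacian_balance (f : V → ℝ) : G.laplacian (Fintype.balance f) = G.laplacian f := by
  rw [Fintype.balance, map_sub]
  exact (congrArg _ (G.laplacian_const _)).trans (sub_zero _)

theorem HasSpectralGap.le_of_laplacian_eq_smul {d δ : ℝ} (hd : 0 < d) (hG : G.IsRegular d)
    (hgap : G.HasSpectralGap δ) {μ : ℝ} {u : V → ℝ} (hu : u ≠ 0) (hu0 : ∑ x, u x = 0)
    (hμ : G.laplacian u = μ • u) : δ * d ≤ μ := by
  have hwalk : Matrix.mulVec (Matrix.of G.walkProb) u = (1 - μ / d) • u := by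
    funext x
    change G.walkProb x ⬝ᵥ u = _
    rw [walkProb_dotProduct (hd.trans_eq (hG x).symm), hG x, hμ]
    simp only [Pi.smul_apply, smul_eq_mul]
    ring
  rw [← le_div_iff₀ hd]
  linarith [hgap _ u hu hu0 hwalk]

open scoped InnerProductSpace in
theorem HasSpectralGap.hasPoincare {d δ : ℝ} (hd : 0 < d) (hG : G.IsRegular d)
    (hgap : G.HasSpectralGap δ) : G.HasPoincare (δ * d) := fun f => by
  let e := WithLp.linearEquiv 2 ℝ (V → ℝ)
  let T : EuclideanSpace ℝ V →ₗ[ℝ] EuclideanSpace ℝ V := e.symm.conj G.laplacian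
  have hT_inner (f g : EuclideanSpace ℝ V) : ⟪T f, g⟫_ℝ = g.ofLp ⬝ᵥ G.laplacian f.ofLp := rfl
  have hT : T.IsSymmetric := fun f g => by
    rw [hT_inner, real_inner_comm, hT_inner, dotProduct_laplacian_comm]
  let W : Submodule ℝ (EuclideanSpace ℝ V) :=
    LinearMap.ker ((∑ x, LinearMap.proj x : (V → ℝ) →ₗ[ℝ] ℝ) ∘ₗ e.toLinearMap)
  have hW {f : EuclideanSpace ℝ V} : f ∈ W ↔ ∑ x, f x = 0 := by
    simp [W, e]
  have hTW (f : EuclideanSpace ℝ V) (_ : f ∈ W) : T f ∈ W := hW.2 (G.sum_laplacian _)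
  have heigen (μ : ℝ) (hμ : Module.End.HasEigenvalue (T.restrict hTW) μ) : δ * d ≤ μ := by
    obtain ⟨u, hu⟩ := hμ.exists_hasEigenvector
    refine hgap.le_of_laplacian_eq_smul hd hG (u := u.1.ofLp) (fun h => hu.2 ?_) (hW.1 u.2) ?_
    · exact Subtype.ext (WithLp.ofLp_injective 2 h)
    · exact congrArg (fun f : W => f.1.ofLp) hu.apply_eq_smul
  have hf : WithLp.toLp 2 (Fintype.balance f) ∈ W := hW.2 (Fintype.sum_balance f)
  have hrayleigh := mul_norm_sq_le_inner_of_forall_hasEigenvalue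
    (hT.restrict_invariant hTW) heigen ⟨_, hf⟩
  rw [Submodule.coe_norm, EuclideanSpace.real_norm_sq_eq] at hrayleigh
  refine hrayleigh.trans_eq ?_
  change Fintype.balance f ⬝ᵥ G.laplacian (Fintype.balance f) = _
  rw [laplacian_balance, dotProduct_laplacian_comm, laplacian_balance, dotProduct_laplacian_comm]

theorem HasPoincare.isGrounded (hG : G.HasPoincare κ) (hκ : 0 < κ) (hM : M.Nonempty) :
    G.IsGrounded M := fun f hf henergy => by
  obtain ⟨a, ha⟩ := hM
  funext x
  have hvar : ∑ z, Fintype.balance f z ^ 2 ≤ 0 :=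
    nonpos_of_mul_nonpos_right ((hG f).trans_eq henergy) hκ
  have hsq : f x ^ 2 ≤ 0 := by
    simpa [hf a ha] using (sq_sub_le_two_mul_sum_sq_balance f x a).trans
      (mul_nonpos_of_nonneg_of_nonpos two_pos.le hvar)
  exact pow_eq_zero_iff two_ne_zero |>.1 (hsq.antisymm (sq_nonneg _))

section Potential

variable [DecidableEq V] {x : V} {v : V → ℝ}

theorem HasPoincare.sum_sq_balance_le (hG : G.HasPoincare κ)
    (hv : G.IsDirichletSolution M (Pi.single x 1) v) :
    κ * ∑ y, Fintype.balance v y ^ 2 ≤ v x := by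
  rw [← dotProduct_single_one v x, ← hv.dotProduct_laplacian_eq hv.eq_zero]
  exact hG v

theorem HasPoincare.mul_le_two (hG : G.HasPoincare κ) (hκ : 0 < κ) (hM : M.Nonempty)
    (hv : G.IsDirichletSolution M (Pi.single x 1) v) : κ * v x ≤ 2 := by
  by_cases hx : x ∈ M
  · simp [hv.eq_zero x hx]
  obtain ⟨a, ha⟩ := hM
  have hsq := sq_sub_le_two_mul_sum_sq_balance v x a
  rw [hv.eq_zero a ha, sub_zero] at hsq
  refine le_of_mul_le_mul_right ?_ (hv.self_pos (hG.isGrounded hκ ⟨a, ha⟩) hx)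
  linarith [mul_le_mul_of_nonneg_left hsq hκ.le, hG.sum_sq_balance_le hv]

end Potential

section MeanHittingTime

variable {h u : V → ℝ} {Δ : ℝ}

theorem HasPoincare.card_mul_expect_le (hG : G.HasPoincare κ) (hκ : 0 < κ) (hM : M.Nonempty)
    (hΔ : ∀ x, G.degree x ≤ Δ) (hh : G.IsDirichletSolution M G.degree h) :
    κ * (M.card * 𝔼 x, h x) ≤ Δ * Fintype.card V := by
  have hh0 := hh.nonneg (hG.isGrounded hκ hM) fun x _ => G.degree_nonneg x
  obtain ⟨a, -⟩ := hM
  obtain hmean | hmean := (Finset.expect_nonneg fun x _ => hh0 x : 0 ≤ 𝔼 x, h x).eq_or_lt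
  · rw [← hmean, mul_zero, mul_zero]
    exact mul_nonneg ((G.degree_nonneg a).trans (hΔ a)) (Nat.cast_nonneg _)
  refine le_of_mul_le_mul_right ?_ hmean
  calc κ * (M.card * 𝔼 x, h x) * 𝔼 x, h x = κ * (M.card * (𝔼 x, h x) ^ 2) := by ring
    _ ≤ κ * ∑ x, Fintype.balance h x ^ 2 := by
        gcongr
        exact card_mul_sq_expect_le hh.eq_zero
    _ ≤ h ⬝ᵥ G.laplacian h := hG h
    _ = ∑ x, h x * G.degree x := hh.dotProduct_laplacian_eq hh.eq_zero
    _ ≤ ∑ x, h x * Δ := by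
        gcongr with x
        exacts [hh0 x, hΔ x]
    _ = Δ * Fintype.card V * 𝔼 x, h x := by
        rw [← Finset.sum_mul, mul_assoc, Fintype.card_mul_expect, mul_comm]

theorem HasPoincare.mul_card_lt_le (hG : G.HasPoincare κ) (hκ : 0 < κ) (hΔ : 0 ≤ Δ)
    (hu : ∀ x, G.laplacian u x ≤ Δ) {a b : ℝ} (hb : 0 < b)
    (ha : (Fintype.card V : ℝ) ≤ 2 * ({x | u x ≤ a} : Finset V).card) :
    κ * b * ({x | a + b < u x} : Finset V).card ≤
      3 * Δ * ({x | a < u x} : Finset V).card := by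
  -- The Poincaré inequality is tested on the truncation of `u` to the levels from `a` to `a + b`.
  let φ (t : ℝ) : ℝ := max 0 (min b (t - a))
  let f : V → ℝ := φ ∘ u
  have hf0 (x : V) : 0 ≤ f x := le_max_left _ _
  have hvar : ∑ x, f x ^ 2 ≤ 3 * ∑ x, Fintype.balance f x ^ 2 := by
    have hsupport := card_mul_sq_expect_le (S := {x | u x ≤ a}) (f := f) fun x hx => by
      have hxa := (Finset.mem_filter.1 hx).2
      exact max_eq_left (min_le_of_right_le (sub_nonpos.2 hxa))
    rw [sum_sq_eq_sum_sq_balance_add f]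
    linarith [mul_le_mul_of_nonneg_right ha (sq_nonneg (𝔼 x, f x))]
  have henergy : κ * ∑ x, Fintype.balance f x ^ 2 ≤ Δ * ∑ x, f x :=
    calc κ * ∑ x, Fintype.balance f x ^ 2 ≤ f ⬝ᵥ G.laplacian f := hG f
      _ ≤ f ⬝ᵥ G.laplacian u := G.dotProduct_laplacian_comp_le
          (fun s t hst => by simp only [φ]; gcongr) (fun s t hst => by grind) u
      _ ≤ ∑ x, f x * Δ := by
          unfold dotProduct
          gcongr with x
          exacts [hf0 x, hu x]
      _ = Δ * ∑ x, f x := by rw [← Finset.sum_mul, mul_comm]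
  have hupper : ∑ x, f x ≤ ({x | a < u x} : Finset V).card * b := by
    rw [← nsmul_eq_mul, ← Finset.sum_const, Finset.sum_filter]
    gcongr with x
    simp only [f, φ, Function.comp_apply]
    grind
  have hlower : ({x | a + b < u x} : Finset V).card * b ^ 2 ≤ ∑ x, f x ^ 2 := by
    rw [← nsmul_eq_mul]
    refine (Finset.card_nsmul_le_sum _ (fun x => f x ^ 2) _ fun x hx => ?_).trans
      (Finset.sum_le_univ_sum_of_nonneg fun x => sq_nonneg _)
    have hxb := (Finset.mem_filter.1 hx).2
    have hfx : f x = b := by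
      simp only [f, φ, Function.comp_apply]
      grind
    rw [hfx]
  refine le_of_mul_le_mul_right ?_ hb
  linarith [mul_le_mul_of_nonneg_left (hlower.trans hvar) hκ.le,
    mul_le_mul_of_nonneg_left hupper hΔ]

theorem HasPoincare.card_lt_le_exp_neg (hG : G.HasPoincare κ) (hκ : 0 < κ) (hΔ : 0 < Δ)
    (hu : ∀ x, G.laplacian u x ≤ Δ) {a : ℝ}
    (ha : (Fintype.card V : ℝ) ≤ 2 * ({x | u x ≤ a} : Finset V).card) (k : ℕ) :
    (({x | a + k * (3 * Real.exp 1 * Δ / κ) < u x} : Finset V).card : ℝ) ≤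
      Real.exp (-k) * Fintype.card V := by
  set b : ℝ := 3 * Real.exp 1 * Δ / κ with hb
  have hb0 : 0 < b := by positivity
  induction k with
  | zero => simpa using Finset.card_le_univ _
  | succ k ih =>
    have hhalf : (Fintype.card V : ℝ) ≤ 2 * ({x | u x ≤ a + k * b} : Finset V).card := by
      refine ha.trans ?_
      gcongr
      exact le_add_of_nonneg_right (by positivity)
    have hdecay := hG.mul_card_lt_le hκ hΔ.le hu hb0 hhalf
    have hstep : Real.exp 1 * ({x | a + (k + 1 : ℕ) * b < u x} : Finset V).card ≤
        Real.exp (-k) * Fintype.card V := by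
      refine (le_of_mul_le_mul_left ?_ (by positivity : 0 < 3 * Δ)).trans ih
      have hlevel : a + (k + 1 : ℕ) * b = a + k * b + b := by push_cast; ring
      have hscale : κ * b = 3 * Δ * Real.exp 1 := by rw [hb]; field_simp
      rw [hlevel, ← mul_assoc, ← hscale]
      exact hdecay
    refine le_of_mul_le_mul_left (hstep.trans_eq ?_) (Real.exp_pos 1)
    rw [← mul_assoc, ← Real.exp_add]
    push_cast
    ring_nf

theorem HasPoincare.le_add_mul_log (hG : G.HasPoincare κ) (hκ : 0 < κ) (hΔ : 0 < Δ)
    (hu : ∀ x, G.laplacian u x ≤ Δ) {a : ℝ}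
    (ha : (Fintype.card V : ℝ) ≤ 2 * ({x | u x ≤ a} : Finset V).card) (x : V) :
    u x ≤ a + (Real.log (Fintype.card V) + 1) * (3 * Real.exp 1 * Δ / κ) := by
  have hn : (0 : ℝ) < Fintype.card V := by exact_mod_cast Fintype.card_pos_iff.2 ⟨x⟩
  have hlog : 0 ≤ Real.log (Fintype.card V) := Real.log_natCast_nonneg _
  let k : ℕ := ⌊Real.log (Fintype.card V)⌋₊ + 1
  have hk : Real.log (Fintype.card V) < k := by exact_mod_cast Nat.lt_floor_add_one _
  have hk' : (k : ℝ) ≤ Real.log (Fintype.card V) + 1 := by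
    push_cast [k]
    exact add_le_add_left (Nat.floor_le hlog) 1
  have hempty : ({x | a + k * (3 * Real.exp 1 * Δ / κ) < u x} : Finset V).card < 1 := by
    rw [← Nat.cast_lt (α := ℝ), Nat.cast_one]
    refine (hG.card_lt_le_exp_neg hκ hΔ hu ha k).trans_lt ?_
    rwa [Real.exp_neg, inv_mul_lt_one₀ (Real.exp_pos _), ← Real.log_lt_iff_lt_exp hn]
  have hx : u x ≤ a + k * (3 * Real.exp 1 * Δ / κ) := by
    simp only [Nat.lt_one_iff, Finset.card_eq_zero, Finset.filter_eq_empty_iff, not_lt] at hempty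
    exact hempty (Finset.mem_univ x)
  refine hx.trans ?_
  gcongr

theorem IsDirichletSolution.laplacian_le (hM : G.IsGrounded M)
    (hh : G.IsDirichletSolution M G.degree h) (hΔ : ∀ x, G.degree x ≤ Δ) (x : V) :
    G.laplacian h x ≤ Δ := by
  by_cases hx : x ∈ M
  · rw [laplacian_apply, hh.eq_zero x hx]
    refine (Finset.sum_nonpos fun y _ => ?_).trans ((G.degree_nonneg x).trans (hΔ x))
    rw [zero_sub, mul_neg]
    exact neg_nonpos.2 (mul_nonneg (G.nonneg x y) (hh.nonneg hM (fun z _ => G.degree_nonneg z) y))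
  · exact (hh.laplacian_eq x hx).trans_le (hΔ x)

theorem HasPoincare.meanHittingTime_le (hG : G.HasPoincare κ) (hκ : 0 < κ) (hM : M.Nonempty)
    (hΔ : ∀ x, G.degree x ≤ Δ) (hh : G.IsDirichletSolution M G.degree h) (x : V) :
    h x ≤ 11 * (Δ / κ) * (Fintype.card V / M.card + Real.log (Fintype.card V)) := by
  have hgrounded := hG.isGrounded hκ hM
  by_cases hx : x ∈ M
  · have hΔ0 : 0 ≤ Δ := (G.degree_nonneg x).trans (hΔ x)
    have := Real.log_natCast_nonneg (Fintype.card V)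
    rw [hh.eq_zero x hx]
    positivity
  have hΔ0 : 0 < Δ := (hgrounded.degree_pos hx).trans_le (hΔ x)
  have hm : (0 : ℝ) < M.card := by exact_mod_cast hM.card_pos
  have hmn : 1 ≤ (Fintype.card V : ℝ) / M.card := by
    rw [one_le_div hm]
    exact_mod_cast Finset.card_le_univ M
  have hmean : 2 * 𝔼 y, h y ≤ 2 * (Δ / κ) * (Fintype.card V / M.card) := by
    have := hG.card_mul_expect_le hκ hM hΔ hh
    rw [mul_assoc, div_mul_div_comm]
    gcongr
    rw [le_div_iff₀ (by positivity)]
    linarith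
  have hhalf := card_le_two_mul_card_filter_le (hh.nonneg hgrounded fun y _ => G.degree_nonneg y)
    (by positivity) hmean
  calc h x ≤ 2 * (Δ / κ) * (Fintype.card V / M.card) +
        (Real.log (Fintype.card V) + 1) * (3 * Real.exp 1 * Δ / κ) :=
        hG.le_add_mul_log hκ hΔ0 (hh.laplacian_le hgrounded hΔ) hhalf x
    _ = (Δ / κ) * (2 * (Fintype.card V / M.card) +
          3 * Real.exp 1 * (Real.log (Fintype.card V) + 1)) := by ring
    _ ≤ (Δ / κ) * (2 * (Fintype.card V / M.card) + 9 * (Real.log (Fintype.card V) + 1)) := by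
        gcongr
        linarith [Real.exp_one_lt_three]
    _ ≤ (Δ / κ) * (11 * (Fintype.card V / M.card + Real.log (Fintype.card V))) := by
        gcongr
        linarith [Real.log_natCast_nonneg (Fintype.card V)]
    _ = _ := by ring

end MeanHittingTime

/-! ### Resistances and stopping times of expanders -/

section Bounds

variable {Δ : ℝ} {x : V}

theorem inv_degree_le_effectiveResistance (hM : G.IsGrounded M) (hx : x ∉ M) :
    (G.degree x)⁻¹ ≤ G.effectiveResistance M x := by
  classical
  obtain ⟨v, hv⟩ := hM.exists_isDirichletSolution (Pi.single x 1)
  rw [effectiveResistance_eq hv]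
  exact (inv_le_iff_one_le_mul₀' (hM.degree_pos hx)).2 (hv.one_le_degree_mul hM hx)

theorem HasPoincare.effectiveResistance_le (hG : G.HasPoincare κ) (hκ : 0 < κ) (hM : M.Nonempty)
    (x : V) : G.effectiveResistance M x ≤ 2 / κ := by
  classical
  obtain ⟨v, hv⟩ := (hG.isGrounded hκ hM).exists_isDirichletSolution (Pi.single x 1)
  rw [effectiveResistance_eq hv, le_div_iff₀' hκ]
  exact hG.mul_le_two hκ hM hv

theorem HasPoincare.degree_dotProduct_sq_div_le [DecidableEq V] {d : ℝ} {h v : V → ℝ}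
    (hG : G.HasPoincare κ) (hκ : 0 < κ) (hd : G.IsRegular d) (hM : M.Nonempty)
    (hh : G.IsDirichletSolution M G.degree h)
    (hv : G.IsDirichletSolution M (Pi.single x 1) v) (hx : x ∉ M) :
    G.degree ⬝ᵥ v ^ 2 / v x ≤ d / κ + h x ^ 2 / Fintype.card V := by
  have hgrounded := hG.isGrounded hκ hM
  have hvx := hv.self_pos hgrounded hx
  have hd0 : 0 ≤ d := hd x ▸ G.degree_nonneg x
  have hn : (0 : ℝ) < Fintype.card V := by exact_mod_cast Fintype.card_pos_iff.2 ⟨x⟩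
  have hhx : h x = d * (Fintype.card V * 𝔼 y, v y) := by
    rw [← dotProduct_single_one h x, hh.reciprocity hv, Fintype.card_mul_expect, Finset.mul_sum]
    exact Finset.sum_congr rfl fun y _ => by rw [hd y, mul_comm]
  have hvar : d * ∑ y, Fintype.balance v y ^ 2 ≤ d / κ * v x := by
    rw [div_mul_eq_mul_div, mul_div_assoc]
    gcongr
    exact (le_div_iff₀' hκ).2 (hG.sum_sq_balance_le hv)
  have hmean : d * (Fintype.card V * (𝔼 y, v y) ^ 2) ≤ h x ^ 2 / Fintype.card V * v x :=
    calc d * (Fintype.card V * (𝔼 y, v y) ^ 2)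
        ≤ d * (Fintype.card V * (𝔼 y, v y) ^ 2) * (d * v x) := by
          refine le_mul_of_one_le_right (by positivity) ?_
          simpa only [hd x] using hv.one_le_degree_mul hgrounded hx
      _ = h x ^ 2 / Fintype.card V * v x := by
          rw [hhx]
          field_simp
  calc G.degree ⬝ᵥ v ^ 2 / v x = d * ∑ y, v y ^ 2 / v x := by
        simp only [dotProduct, Finset.mul_sum, Finset.sum_div, hd _, Pi.pow_apply, mul_div_assoc]
    _ ≤ d / κ + h x ^ 2 / Fintype.card V := by
        rw [← Finset.sum_div, ← mul_div_assoc, div_le_iff₀ hvx, sum_sq_eq_sum_sq_balance_add]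
        linarith

variable [MeasurableSpace V] [DiscreteMeasurableSpace V]

theorem HasPoincare.hittingTime_le (hG : G.HasPoincare κ) (hκ : 0 < κ) (hM : M.Nonempty)
    (hΔ : ∀ x, G.degree x ≤ Δ) (x : V) :
    G.hittingTime M x ≤ ENNReal.ofReal
      (11 * (Δ / κ) * (Fintype.card V / M.card + Real.log (Fintype.card V))) := by
  have hgrounded := hG.isGrounded hκ hM
  obtain ⟨h, hh⟩ := hgrounded.exists_isDirichletSolution G.degree
  exact (WeightedGraph.hittingTime_le hgrounded hh x).trans
    (ENNReal.ofReal_le_ofReal (hG.meanHittingTime_le hκ hM hΔ hh x))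

theorem HasPoincare.electricHittingTime_le (hG : G.HasPoincare κ) (hκ : 0 < κ) (hM : M.Nonempty)
    (hΔ : ∀ x, G.degree x ≤ Δ) (x : V) :
    G.electricHittingTime M x ≤ ENNReal.ofReal (22 * (Δ / κ) *
      min (M.card : ℝ) (Fintype.card V / M.card + Real.log (Fintype.card V))) := by
  have hgrounded := hG.isGrounded hκ hM
  obtain ⟨h, hh⟩ := hgrounded.exists_isDirichletSolution G.degree
  have hΔ0 : 0 ≤ Δ := (G.degree_nonneg x).trans (hΔ x)
  rw [mul_min_of_nonneg _ _ (by positivity), ENNReal.ofReal_min]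
  refine le_min ?_ ?_
  · refine (electricHittingTime_le_of_effectiveResistance_le hgrounded
      (hG.effectiveResistance_le hκ hM) x).trans (ENNReal.ofReal_le_ofReal ?_)
    calc 2 * (2 / κ) * ∑ a ∈ M, G.degree a ≤ 2 * (2 / κ) * (M.card * Δ) := by
          gcongr
          rw [← nsmul_eq_mul]
          exact Finset.sum_le_card_nsmul M _ _ fun a _ => hΔ a
      _ = 4 * (Δ / κ) * M.card := by ring
      _ ≤ 22 * (Δ / κ) * M.card := by gcongr; norm_num
  · refine (electricHittingTime_le_two_mul hgrounded hh x).trans (ENNReal.ofReal_le_ofReal ?_)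
    linarith [hG.meanHittingTime_le hκ hM hΔ hh x]

theorem HasPoincare.escapeTime_le {d : ℝ} (hG : G.HasPoincare κ) (hκ : 0 < κ)
    (hd : G.IsRegular d) (hM : M.Nonempty) (x : V) :
    G.escapeTime M x ≤ ENNReal.ofReal
      ((d / κ + 968 * (d / κ) ^ 2) * (1 + Fintype.card V / (M.card : ℝ) ^ 2)) := by
  classical
  have hgrounded := hG.isGrounded hκ hM
  obtain ⟨h, hh⟩ := hgrounded.exists_isDirichletSolution G.degree
  obtain ⟨v, hv⟩ := hgrounded.exists_isDirichletSolution (Pi.single x 1)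
  refine (WeightedGraph.escapeTime_le hgrounded hv).trans ?_
  by_cases hx : x ∈ M
  · rw [hv.eq_zero x hx, div_zero, ENNReal.ofReal_zero]
    exact zero_le
  have hd0 : 0 ≤ d := hd x ▸ G.degree_nonneg x
  have hn : (1 : ℝ) ≤ Fintype.card V := by exact_mod_cast Fintype.card_pos_iff.2 ⟨x⟩
  have hhx := hG.meanHittingTime_le hκ hM (fun y => (hd y).le) hh x
  have hh0 := hh.nonneg hgrounded (fun y _ => G.degree_nonneg y) x
  refine ENNReal.ofReal_le_ofReal ?_
  calc G.degree ⬝ᵥ v ^ 2 / v x ≤ d / κ + h x ^ 2 / Fintype.card V :=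
        hG.degree_dotProduct_sq_div_le hκ hd hM hh hv hx
    _ ≤ d / κ + (11 * (d / κ) * (Fintype.card V / M.card + Real.log (Fintype.card V))) ^ 2 /
          Fintype.card V := by gcongr
    _ = d / κ + 121 * (d / κ) ^ 2 *
          ((Fintype.card V / M.card + Real.log (Fintype.card V)) ^ 2 / Fintype.card V) := by ring
    _ ≤ d / κ + 121 * (d / κ) ^ 2 * (8 * (1 + Fintype.card V / (M.card : ℝ) ^ 2)) := by
        gcongr
        exact sq_div_add_log_div_le hn
    _ ≤ d / κ * (1 + Fintype.card V / (M.card : ℝ) ^ 2) +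
          121 * (d / κ) ^ 2 * (8 * (1 + Fintype.card V / (M.card : ℝ) ^ 2)) := by
        gcongr
        exact le_mul_of_one_le_right (by positivity) (le_add_of_nonneg_right (by positivity))
    _ = _ := by ring

end Bounds

end WeightedGraph

end

theorem mainTheorem11 (δ d₀ D : ℝ) (hδ : 0 < δ) (hd₀ : 0 < d₀) :
    ∃ c C : ℝ, 0 < c ∧ 0 < C ∧
      ∀ (V : Type*) [Fintype V] [MeasurableSpace V] [DiscreteMeasurableSpace V]
        (G : WeightedGraph V) (d : ℝ), d₀ ≤ d → d ≤ D →
        G.IsRegular d → G.HasSpectralGap δ →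
        ∀ (M : Finset V) (n m : ℕ), M.Nonempty → Fintype.card V = n → M.card = m →
        ∀ x : V,
          (x ∉ M → c ≤ G.effectiveResistance M x) ∧
          G.effectiveResistance M x ≤ C ∧
          G.escapeTime M x ≤ ENNReal.ofReal (C * (1 + (n : ℝ) / (m : ℝ) ^ 2)) ∧
          G.electricHittingTime M x ≤
            ENNReal.ofReal (C * min (m : ℝ) ((n : ℝ) / (m : ℝ) + Real.log (n : ℝ))) ∧
          G.hittingTime M x ≤ ENNReal.ofReal (C * ((n : ℝ) / (m : ℝ) + Real.log (n : ℝ))) := by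
  set C := 2 / (δ * d₀) + (δ⁻¹ + 968 * δ⁻¹ ^ 2) + 22 * δ⁻¹
  refine ⟨(max D d₀)⁻¹, C, inv_pos.2 (lt_max_of_lt_right hd₀), by positivity, ?_⟩
  rintro V _ _ _ G d hd₀d hdD hd hgap M _ _ hM rfl rfl x
  have hd0 : 0 < d := hd₀.trans_le hd₀d
  have hκ : 0 < δ * d := mul_pos hδ hd0
  have hδ_inv : 0 < δ⁻¹ := inv_pos.2 hδ
  have hratio : d / (δ * d) = δ⁻¹ := by field_simp
  have hG := hgap.hasPoincare hd0 hd
  have hdeg (y : V) : G.degree y ≤ d := (hd y).le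
  have := Real.log_natCast_nonneg (Fintype.card V)
  have hR : 0 ≤ 2 / (δ * d₀) := by positivity
  have hET : 0 ≤ δ⁻¹ + 968 * δ⁻¹ ^ 2 := by positivity
  refine ⟨fun hx => ?_, ?_, ?_, ?_, ?_⟩
  · refine (inv_anti₀ hd0 (hdD.trans (le_max_left D d₀))).trans ?_
    exact hd x ▸ WeightedGraph.inv_degree_le_effectiveResistance (hG.isGrounded hκ hM) hx
  · have hR' : 2 / (δ * d) ≤ 2 / (δ * d₀) := by gcongr
    linarith [hG.effectiveResistance_le hκ hM x]
  · refine (hratio ▸ hG.escapeTime_le hκ hd hM x).trans ?_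
    gcongr
    linarith
  · refine (hratio ▸ hG.electricHittingTime_le hκ hM hdeg x).trans ?_
    gcongr
    linarith
  · refine (hratio ▸ hG.hittingTime_le hκ hM hdeg x).trans ?_
    gcongr
    linarith
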